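/- **Proposition 1.** Let $X=[x_1,\dots,x_M]\in\mathbb R^{N\times M}$, $\hat C=\frac1M\sum_{m}x_mx_m^\top$, $\alpha,\beta>0$, $\gamma\ge 0$, $\delta\in\mathbb R$, $\tilde\lambda\in\mathbb R^{\tilde N}$, and let $g:\mathbb R\to\mathbb R$ be concave and differentiable on $(0,\infty)$. For $\lambda\in\mathbb R^n$ put $c_g(\lambda)=\frac1n\sum_{i=1}^n g(\lambda_i)$. Write $\|\cdot\|_1$ for the entrywise $\ell_1$ norm and $\|\cdot\|_F$ for the Frobenius norm. Given a set $\mathcal S\subset\mathbb R^{N\times N}$ of symmetric matrices, consider $$\min_{S,V,\lambda}\ \phi(S,V,\lambda)=\mathrm{tr}(\hat CS)-\log\det(\mathrm{diag}(\lambda))+\alpha\|S\|_1+\tfrac{\beta}{2}\|S-V\mathrm{diag}(\lambda)V^\top\|_F^2+\gamma c_g(\lambda)$$ subject to $S\in\mathcal S$, $V^\top V=I$, $\lambda\in\mathcal L:=\{\lambda\in\mathbb R^N:\lambda_i>0\ \forall i,\ c_g(\lambda)\ge c_g(\tilde\lambda)-\delta\}$. A feasible point $y$ is *stationary* if for every $d$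 in the (Bouligand) tangent cone of the feasible set at $y$ the one-sided directional derivative $\phi'(y;d)$ exists and is $\ge 0$; let $\mathcal Y^*$ be the set of stationary points. Let $(S^{(t)},V^{(t)},\lambda^{(t)})_{t\ge0}$ be any sequence with $\lambda^{(0)}>0$ entrywise such that for all $t\ge 0$: 1. $S^{(t+1)}$ is obtained in one of the two ways (a), (b) below, the same for all $t$; 2. $V^{(t+1)}$ maximizes $\mathrm{tr}(V^\top S^{(t+1)}V\,\mathrm{diag}(\lambda^{(t)}))$ over $V^\top V=I$ (for instance, an orthonormal eigenbasis of $S^{(t+1)}$ ordered consistently with $\lambda^{(t)}$); 3. $\lambda^{(t+1)}$ minimizes $-\sum_j\log\lambda_j+\frac\beta2\|\lambda-\hat\lambda\|_2^2+\gamma\nabla c_g(\lambda^{(t)})^\top\lambda$ over $\lambda\in\mathcal L$, where $\hat\lambda$ is the diagonal of $V^{(t+1)\top}S^{(t+1)}V^{(t+1)}$. (a) $\mathcal S$ is closed and convex, and $S^{(t+1)}$ minimizes $\mathrm{tr}(\hat CS)+\alpha\|S\|_1+\frac\beta2\|S-V^{(t)}\mathrm{diag}(\lambda^{(t)})V^{(t)\top}\|_F^2$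 over $S\in\mathcal S$. (b) $\mathcal S=\{\mathscr S s: s\in\mathbb R^m,\ s\ge0\}$ for an injective linear map $\mathscr S$ from $\mathbb R^m$ to the symmetric $N\times N$ matrices, for which there is a fixed (sign) matrix $H$ with $\|\mathscr Ss\|_1=\mathrm{tr}((\mathscr Ss)H)$ for all $s\ge0$; and $S^{(t+1)}=\mathscr Ss^{(t+1)}$, where $$s^{(t+1)}=\Big(s^{(t)}-\tfrac{1}{\|\mathscr S\|_2^2}\big(\mathscr S^*(\mathscr Ss^{(t)})-z^{(t)}\big)\Big)^+,\qquad z^{(t)}=\mathscr S^*\big(V^{(t)}\mathrm{diag}(\lambda^{(t)})V^{(t)\top}-\beta^{-1}(\hat C+\alpha H)\big),$$ $\mathscr S^*$ is the adjoint for the Euclidean and Frobenius inner products, $\|\mathscr S\|_2^2=\sup_{\|s\|_2=1}\|\mathscr Ss\|_F^2$, and $(\cdot)^+=\max(\cdot,0)$ entrywise. Then the sequence converges to the set of stationary points: the Euclidean distance from $(S^{(t)},V^{(t)},\lambda^{(t)})$ to $\mathcal Y^*$ tends to $0$ as $t\to\infty$; moreover the sequence has at least one limit point, and every limit point belongs to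 $\mathcal Y^*$. -/

import Mathlib

open Filter Matrix

noncomputable section

namespace MotifGL

/-- Squared Frobenius norm. -/
def frobSq {N : ℕ} (A : Matrix (Fin N) (Fin N) ℝ) : ℝ := ∑ i, ∑ j, A i j ^ 2

/-- Entrywise `ℓ¹` norm of a matrix. -/
def l1Norm {N : ℕ} (A : Matrix (Fin N) (Fin N) ℝ) : ℝ := ∑ i, ∑ j, |A i j|

/-- Empirical covariance `(1/M) ∑ₘ xₘ xₘᵀ` of the columns of `X`. -/
def empCov {N M : ℕ} (X : Matrix (Fin N) (Fin M) ℝ) : Matrix (Fin N) (Fin N) ℝ :=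
  (1 / (M : ℝ)) • ∑ m, vecMulVec (fun i => X i m) (fun i => X i m)

/-- `c_g(l) = (1/n) ∑ᵢ g(lᵢ)`. -/
def cg (g : ℝ → ℝ) {n : ℕ} (l : Fin n → ℝ) : ℝ := (1 / (n : ℝ)) * ∑ i, g (l i)

/-- The linear majorizer `u(l, l₀) = ∇c_g(l₀)ᵀ l` of `c_g` (constant terms omitted). -/
def majorizer (g : ℝ → ℝ) {n : ℕ} (l l₀ : Fin n → ℝ) : ℝ := fderiv ℝ (cg g) l₀ l

/-- The triples `(S, V, l)`. -/
abbrev Point (N : ℕ) : Type :=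
  Matrix (Fin N) (Fin N) ℝ × Matrix (Fin N) (Fin N) ℝ × (Fin N → ℝ)

/-- Euclidean distance between two triples (Frobenius norm on the matrix blocks). -/
def pointDist {N : ℕ} (x y : Point N) : ℝ :=
  √(frobSq (x.1 - y.1) + frobSq (x.2.1 - y.2.1) + ∑ i, (x.2.2 i - y.2.2 i) ^ 2)

/-- The data of the relaxed problem, without the feasible set of graph-shift operators:
signals, weights, tolerance, test function, and spectrum of the reference graph. -/
structure Data (N M K : ℕ) where
  X : Matrix (Fin N) (Fin M) ℝ
  α : ℝ
  β : ℝ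
  γ : ℝ
  δ : ℝ
  g : ℝ → ℝ
  lref : Fin K → ℝ

namespace Data

variable {N M K : ℕ} (P : Data N M K)

/-- The objective of the relaxed problem. -/
def objective (x : Point N) : ℝ :=
  trace (empCov P.X * x.1) - Real.log (det (diagonal x.2.2)) + P.α * l1Norm x.1
    + P.β / 2 * frobSq (x.1 - x.2.1 * diagonal x.2.2 * x.2.1ᵀ) + P.γ * cg P.g x.2.2

/-- Admissible spectra: positive (the domain of the log-determinant), and satisfying the
similarity constraint. -/
def spectra : Set (Fin N → ℝ) :=
  {l | (∀ i, 0 < l i) ∧ cg P.g l ≥ cg P.g P.lref - P.δ}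

/-- Feasible set of the relaxed problem, `𝒮` being the set of admissible shift operators. -/
def feasible (𝒮 : Set (Matrix (Fin N) (Fin N) ℝ)) : Set (Point N) :=
  {x | x.1 ∈ 𝒮 ∧ x.2.1ᵀ * x.2.1 = 1 ∧ x.2.2 ∈ P.spectra}

/-- Stationary points: feasible points at which the one-sided directional derivative of the
objective exists and is nonnegative along every direction of the (Bouligand) tangent cone of the
feasible set. -/
def stationary (𝒮 : Set (Matrix (Fin N) (Fin N) ℝ)) : Set (Point N) :=
  {x | x ∈ P.feasible 𝒮 ∧ ∀ d ∈ posTangentConeAt (P.feasible 𝒮) x,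
    ∃ r : ℝ, 0 ≤ r ∧
      HasDerivWithinAt (fun h : ℝ => P.objective (x + h • d)) r (Set.Ici 0) 0}

/-- Objective of Step 1, given `V` and `l`. -/
def step1Obj (V : Matrix (Fin N) (Fin N) ℝ) (l : Fin N → ℝ) (S : Matrix (Fin N) (Fin N) ℝ) : ℝ :=
  trace (empCov P.X * S) + P.α * l1Norm S + P.β / 2 * frobSq (S - V * diagonal l * Vᵀ)

/-- Objective of Step 3, given `S`, `V` and the previous spectrum `l₀`. -/
def step3Obj (S V : Matrix (Fin N) (Fin N) ℝ) (l₀ l : Fin N → ℝ) : ℝ :=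
  -∑ j, Real.log (l j) + P.β / 2 * ∑ j, (l j - (Vᵀ * S * V) j j) ^ 2 + P.γ * majorizer P.g l l₀

/-- `Sn` solves Step 1 exactly, given the previous iterate `x`. -/
def IsExactStep1 (𝒮 : Set (Matrix (Fin N) (Fin N) ℝ)) (x : Point N)
    (Sn : Matrix (Fin N) (Fin N) ℝ) : Prop :=
  Sn ∈ 𝒮 ∧ IsMinOn (P.step1Obj x.2.1 x.2.2) 𝒮 Sn

/-- `Vn` solves Step 2, i.e. maximizes `tr(Vᵀ S V diag(l))` over orthogonal `V`. An orthonormal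
eigenbasis of the symmetric matrix `S`, its columns ordered consistently with `l`, does so. -/
def IsStep2 (S : Matrix (Fin N) (Fin N) ℝ) (l : Fin N → ℝ)
    (Vn : Matrix (Fin N) (Fin N) ℝ) : Prop :=
  Vn ∈ {V : Matrix (Fin N) (Fin N) ℝ | Vᵀ * V = 1} ∧
    IsMaxOn (fun V : Matrix (Fin N) (Fin N) ℝ => trace (Vᵀ * S * V * diagonal l))
      {V | Vᵀ * V = 1} Vn

/-- `ln` solves Step 3. -/
def IsStep3 (S V : Matrix (Fin N) (Fin N) ℝ) (l₀ ln : Fin N → ℝ) : Prop :=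
  ln ∈ P.spectra ∧ IsMinOn (P.step3Obj S V l₀) P.spectra ln

/-- Sequences generated by the three-block algorithm with Step 1 solved exactly. -/
def IsExactRun (𝒮 : Set (Matrix (Fin N) (Fin N) ℝ)) (x : ℕ → Point N) : Prop :=
  (∀ i, 0 < (x 0).2.2 i) ∧ ∀ t,
    P.IsExactStep1 𝒮 (x t) (x (t + 1)).1 ∧
    IsStep2 (x (t + 1)).1 (x t).2.2 (x (t + 1)).2.1 ∧
    P.IsStep3 (x (t + 1)).1 (x (t + 1)).2.1 (x t).2.2 (x (t + 1)).2.2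

/-- The adjoint `𝓢*` for the Euclidean and Frobenius inner products:
`(𝓢* Y)ₖ = ⟨𝓢 eₖ, Y⟩`. -/
def adj {m : ℕ} (𝓢 : (Fin m → ℝ) →ₗ[ℝ] Matrix (Fin N) (Fin N) ℝ)
    (Y : Matrix (Fin N) (Fin N) ℝ) : Fin m → ℝ :=
  fun k => ∑ i, ∑ j, 𝓢 (Pi.single k 1) i j * Y i j

/-- Squared operator norm `sup_{‖s‖₂ = 1} ‖𝓢 s‖_F²`. -/
def opNormSq {m : ℕ} (𝓢 : (Fin m → ℝ) →ₗ[ℝ] Matrix (Fin N) (Fin N) ℝ) : ℝ :=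
  sSup {r | ∃ s : Fin m → ℝ, ∑ k, s k ^ 2 = 1 ∧ r = frobSq (𝓢 s)}

/-- The set of shift operators `{𝓢 s : s ≥ 0}` parametrized by `𝓢`. -/
def cone {m : ℕ} (𝓢 : (Fin m → ℝ) →ₗ[ℝ] Matrix (Fin N) (Fin N) ℝ) :
    Set (Matrix (Fin N) (Fin N) ℝ) :=
  𝓢 '' {s | ∀ k, 0 ≤ s k}

/-- The vector `z = 𝓢*(V diag(l) Vᵀ - β⁻¹ K)`, with `K = Ĉ + α H`. -/
def zVec {m : ℕ} (𝓢 : (Fin m → ℝ) →ₗ[ℝ] Matrix (Fin N) (Fin N) ℝ)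
    (H V : Matrix (Fin N) (Fin N) ℝ) (l : Fin N → ℝ) : Fin m → ℝ :=
  adj 𝓢 (V * diagonal l * Vᵀ - P.β⁻¹ • (empCov P.X + P.α • H))

/-- The projected-gradient update of Step 1,
`(s - ‖𝓢‖⁻² (𝓢*(𝓢 s) - z))⁺`. -/
def gradStep1 {m : ℕ} (𝓢 : (Fin m → ℝ) →ₗ[ℝ] Matrix (Fin N) (Fin N) ℝ)
    (H V : Matrix (Fin N) (Fin N) ℝ) (l : Fin N → ℝ) (s : Fin m → ℝ) : Fin m → ℝ :=
  fun k => max (s k - 1 / opNormSq 𝓢 * (adj 𝓢 (𝓢 s) k - P.zVec 𝓢 H V l k)) 0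

/-- Sequences generated by the three-block algorithm with the projected-gradient update in
Step 1; `s` is the auxiliary sequence parametrizing the matrices `S`. -/
def IsGradRun {m : ℕ} (𝓢 : (Fin m → ℝ) →ₗ[ℝ] Matrix (Fin N) (Fin N) ℝ)
    (H : Matrix (Fin N) (Fin N) ℝ) (s : ℕ → Fin m → ℝ) (x : ℕ → Point N) : Prop :=
  (∀ i, 0 < (x 0).2.2 i) ∧ ∀ t,
    s (t + 1) = P.gradStep1 𝓢 H (x t).2.1 (x t).2.2 (s t) ∧
    (x (t + 1)).1 = 𝓢 (s (t + 1)) ∧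
    IsStep2 (x (t + 1)).1 (x t).2.2 (x (t + 1)).2.1 ∧
    P.IsStep3 (x (t + 1)).1 (x (t + 1)).2.1 (x t).2.2 (x (t + 1)).2.2

end Data

/-- `x` converges to the set `Y`: the distance from `x t` to `Y` tends to zero, there is a limit
point, and every limit point lies in `Y`. -/
def ConvergesToSet {N : ℕ} (x : ℕ → Point N) (Y : Set (Point N)) : Prop :=
  (∀ ε > 0, ∀ᶠ t in atTop, ∃ y ∈ Y, pointDist (x t) y < ε) ∧
    (∃ y, MapClusterPt y atTop x) ∧
    ∀ y, MapClusterPt y atTop x → y ∈ Y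

end MotifGL

end

/-!
Each sweep decreases the objective by a multiple of the squared steps in `S` and `l`: with the
other blocks fixed, the exact subproblems are strongly convex in these variables, and the
projected-gradient update, with step length the inverse Lipschitz constant of the gradient, obeys
the same descent inequality; replacing `c_g` by its tangent costs nothing because `g` is concave.
As the objective is coercive on the feasible set, the iterates stay in a compact set and these
steps tend to zero, so that every limit point solves its own three subproblems.  The blocks
interact only through a differentiable term, and the nonsmooth `ℓ¹` penalty involves `S` alone;
adding up the three first-order conditions therefore gives stationarity for the whole problem.
-/

namespace MotifGL

open scoped Topology

variable {N M K : ℕ}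

section ConcaveOneVariable

variable {g : ℝ → ℝ} {s : Set ℝ}

theorem concaveOn_le_tangent (hc : ConcaveOn ℝ s g) {a b : ℝ} (ha : a ∈ s) (hb : b ∈ s)
    (hd : DifferentiableAt ℝ g a) : g b ≤ g a + deriv g a * (b - a) := by
  rcases lt_trichotomy a b with h | rfl | h
  · have := hc.slope_le_deriv ha hb h hd
    rw [slope_def_field, div_le_iff₀ (sub_pos.2 h)] at this
    linarith
  · simp
  · have := hc.deriv_le_slope hb ha h hd
    rw [slope_def_field, le_div_iff₀ (sub_pos.2 h)] at this
    linarith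

/- A secant slope at `a` close to `g' a` stays close when `a` moves slightly, and by concavity it
bounds the derivatives at the nearby points on one side. -/
theorem concaveOn_continuousAt_deriv (hs : IsOpen s) (hc : ConcaveOn ℝ s g)
    (hd : ∀ x ∈ s, DifferentiableAt ℝ g x) {a : ℝ} (ha : a ∈ s) : ContinuousAt (deriv g) a := by
  have mem_s : ∀ᶠ x in 𝓝 a, x ∈ s := hs.mem_nhds ha
  have slope_tendsto := (hd a ha).hasDerivAt.tendsto_slope
  have slope_continuousAt : ∀ b ≠ a, Tendsto (fun x => slope g x b) (𝓝 a) (𝓝 (slope g a b)) := by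
    intro b hb
    simp only [slope_def_field]
    exact (tendsto_const_nhds.sub (hd a ha).continuousAt).div (tendsto_const_nhds.sub tendsto_id)
      (sub_ne_zero.2 hb)
  refine tendsto_order.2 ⟨fun c hca => ?_, fun c hca => ?_⟩
  · obtain ⟨b, hcb, hbs, hab : a < b⟩ :=
      (((slope_tendsto.mono_left (nhdsGT_le_nhdsNE a)).eventually (lt_mem_nhds hca)).and
        ((mem_s.filter_mono nhdsWithin_le_nhds).and self_mem_nhdsWithin)).exists
    filter_upwards [(slope_continuousAt b hab.ne').eventually (lt_mem_nhds hcb), mem_s,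
      gt_mem_nhds hab] with x hx hxs hxb
    exact hx.trans_le (hc.slope_le_deriv hxs hbs hxb (hd x hxs))
  · obtain ⟨b, hbc, hbs, hba : b < a⟩ :=
      (((slope_tendsto.mono_left (nhdsLT_le_nhdsNE a)).eventually (gt_mem_nhds hca)).and
        ((mem_s.filter_mono nhdsWithin_le_nhds).and self_mem_nhdsWithin)).exists
    filter_upwards [(slope_continuousAt b hba.ne).eventually (gt_mem_nhds hbc), mem_s,
      lt_mem_nhds hba] with x hx hxs hbx
    rw [slope_comm] at hx
    exact (hc.deriv_le_slope hbs hxs hbx (hd x hxs)).trans_lt hx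

end ConcaveOneVariable

section SpectralMean

variable {g : ℝ → ℝ} {n : ℕ}

theorem hasFDerivAt_cg {l : Fin n → ℝ} (hd : ∀ i, DifferentiableAt ℝ g (l i)) :
    HasFDerivAt (cg g) ((1 / (n : ℝ)) • ∑ i, deriv g (l i) •
      (ContinuousLinearMap.proj i : (Fin n → ℝ) →L[ℝ] ℝ)) l :=
  HasFDerivAt.const_mul (HasFDerivAt.fun_sum fun i _ =>
    (hd i).hasDerivAt.comp_hasFDerivAt l (hasFDerivAt_apply i l)) _

theorem majorizer_eq {l₀ : Fin n → ℝ} (hd : ∀ i, DifferentiableAt ℝ g (l₀ i)) (l : Fin n → ℝ) :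
    majorizer g l l₀ = (1 / (n : ℝ)) * ∑ i, deriv g (l₀ i) * l i := by
  simp [majorizer, (hasFDerivAt_cg hd).fderiv]

theorem cg_le_majorizer {s : Set ℝ} (hc : ConcaveOn ℝ s g) {l l₀ : Fin n → ℝ}
    (hl : ∀ i, l i ∈ s) (hl₀ : ∀ i, l₀ i ∈ s) (hd : ∀ i, DifferentiableAt ℝ g (l₀ i)) :
    cg g l ≤ cg g l₀ + majorizer g l l₀ - majorizer g l₀ l₀ := by
  rw [majorizer_eq hd, majorizer_eq hd, cg, cg, ← mul_add, ← mul_sub, ← Finset.sum_add_distrib,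
    ← Finset.sum_sub_distrib]
  gcongr with i
  have := concaveOn_le_tangent hc (hl₀ i) (hl i) (hd i)
  linarith

theorem concaveOn_cg {s : Set ℝ} (hc : ConcaveOn ℝ s g) :
    ConcaveOn ℝ (Set.univ.pi fun _ : Fin n => s) (cg g) := by
  refine ConcaveOn.smul (c := 1 / (n : ℝ)) (by positivity)
    ⟨convex_pi fun _ _ => hc.1, fun x hx y hy a b ha hb hab => ?_⟩
  simp only [smul_eq_mul, Finset.mul_sum, ← Finset.sum_add_distrib]
  exact Finset.sum_le_sum fun i _ => hc.2 (hx i trivial) (hy i trivial) ha hb hab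

theorem tendsto_majorizer {s : Set ℝ} (hs : IsOpen s) (hc : ConcaveOn ℝ s g)
    (hd : ∀ x ∈ s, DifferentiableAt ℝ g x) {ι : Type*} {F : Filter ι} {u u₀ : ι → Fin n → ℝ}
    {l l₀ : Fin n → ℝ} (hl₀ : ∀ i, l₀ i ∈ s) (hu : Tendsto u F (𝓝 l))
    (hu₀ : Tendsto u₀ F (𝓝 l₀)) :
    Tendsto (fun t => majorizer g (u t) (u₀ t)) F (𝓝 (majorizer g l l₀)) := by
  have hu := tendsto_pi_nhds.1 hu
  have hu₀ := tendsto_pi_nhds.1 hu₀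
  have hu₀s : ∀ᶠ t in F, ∀ i, u₀ t i ∈ s :=
    eventually_all.2 fun i => (hu₀ i).eventually (hs.mem_nhds (hl₀ i))
  rw [majorizer_eq fun i => hd _ (hl₀ i)]
  refine Tendsto.congr' (hu₀s.mono fun t ht => (majorizer_eq (fun i => hd _ (ht i)) (u t)).symm) ?_
  exact (tendsto_finsetSum _ fun i _ => ((concaveOn_continuousAt_deriv hs hc hd
    (hl₀ i)).tendsto.comp (hu₀ i)).mul (hu i)).const_mul _

end SpectralMean

theorem trace_transpose_mul_eq_sum {m n R : Type*} [Fintype m] [Fintype n]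
    [NonUnitalNonAssocSemiring R] (A B : Matrix m n R) :
    trace (Aᵀ * B) = ∑ i, ∑ j, A i j * B i j := by
  simp only [trace, diag_apply, mul_apply, transpose_apply]
  exact Finset.sum_comm

theorem trace_mul_diagonal {n R : Type*} [Fintype n] [DecidableEq n] [NonUnitalNonAssocSemiring R]
    (A : Matrix n n R) (l : n → R) : trace (A * diagonal l) = ∑ j, A j j * l j := by
  simp only [trace, diag_apply, mul_diagonal]

section Frobenius

variable (A B S : Matrix (Fin N) (Fin N) ℝ) {V : Matrix (Fin N) (Fin N) ℝ} (l : Fin N → ℝ)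

theorem frobSq_eq_trace : frobSq A = trace (Aᵀ * A) := by
  simp only [trace_transpose_mul_eq_sum, frobSq, sq]

theorem frobSq_nonneg : 0 ≤ frobSq A := by
  unfold frobSq; positivity

theorem frobSq_eq_zero_iff {A : Matrix (Fin N) (Fin N) ℝ} : frobSq A = 0 ↔ A = 0 := by
  rw [frobSq_eq_trace, ← conjTranspose_eq_transpose_of_trivial,
    trace_conjTranspose_mul_self_eq_zero_iff]

theorem frobSq_smul (c : ℝ) : frobSq (c • A) = c ^ 2 * frobSq A := by
  simp only [frobSq, Matrix.smul_apply, smul_eq_mul, mul_pow, Finset.mul_sum]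

theorem frobSq_add : frobSq (A + B) = frobSq A + 2 * trace (Aᵀ * B) + frobSq B := by
  rw [trace_transpose_mul_eq_sum]
  simp only [frobSq, Matrix.add_apply, add_sq, Finset.mul_sum, Finset.sum_add_distrib, mul_assoc]

theorem frobSq_sub : frobSq (A - B) = frobSq A - 2 * trace (Aᵀ * B) + frobSq B := by
  rw [trace_transpose_mul_eq_sum]
  simp only [frobSq, Matrix.sub_apply, sub_sq, Finset.mul_sum, Finset.sum_add_distrib,
    Finset.sum_sub_distrib, mul_assoc]

theorem frobSq_conj_diagonal (hV : Vᵀ * V = 1) :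
    frobSq (V * diagonal l * Vᵀ) = ∑ j, l j ^ 2 := by
  have h : (V * diagonal l * Vᵀ)ᵀ * (V * diagonal l * Vᵀ)
      = V * (diagonal l * (Vᵀ * V) * diagonal l) * Vᵀ := by
    simp only [transpose_mul, transpose_transpose, diagonal_transpose, Matrix.mul_assoc]
  rw [frobSq_eq_trace, h, trace_mul_comm, ← Matrix.mul_assoc, hV, Matrix.one_mul, Matrix.mul_one,
    diagonal_mul_diagonal, trace_diagonal]
  simp only [sq]

theorem trace_transpose_mul_conj_diagonal (V : Matrix (Fin N) (Fin N) ℝ) :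
    trace (Sᵀ * (V * diagonal l * Vᵀ)) = trace (Vᵀ * S * V * diagonal l) := by
  rw [← trace_transpose]
  simp only [transpose_mul, transpose_transpose, diagonal_transpose]
  rw [Matrix.mul_assoc V, trace_mul_comm, trace_mul_comm _ (diagonal l)]
  simp only [← Matrix.mul_assoc]

theorem frobSq_sub_conj_diagonal (hV : Vᵀ * V = 1) :
    frobSq (S - V * diagonal l * Vᵀ)
      = frobSq S - 2 * trace (Vᵀ * S * V * diagonal l) + ∑ j, l j ^ 2 := by
  rw [frobSq_sub, frobSq_conj_diagonal l hV, trace_transpose_mul_conj_diagonal]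

theorem frobSq_sub_conj_diagonal_eq_add_sum_sq (hV : Vᵀ * V = 1) :
    frobSq (S - V * diagonal l * Vᵀ)
      = frobSq (S - V * diagonal (diag (Vᵀ * S * V)) * Vᵀ)
        + ∑ j, (l j - (Vᵀ * S * V) j j) ^ 2 := by
  simp only [frobSq_sub_conj_diagonal S _ hV, trace_mul_diagonal, diag_apply, sub_sq,
    Finset.sum_add_distrib, Finset.sum_sub_distrib, Finset.mul_sum]
  have h : ∀ j, 2 * l j * (Vᵀ * S * V) j j = 2 * ((Vᵀ * S * V) j j * l j) := fun j => by ring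
  simp only [h, ← sq, ← Finset.mul_sum]
  ring

end Frobenius

theorem quadratic_growth_of_isMinOn {ι E : Type*} [Fintype ι] [AddCommGroup E] [Module ℝ E]
    {C : Set E} {ψ : E → ℝ} (hψ : ConvexOn ℝ C ψ) (L : ι → E →ₗ[ℝ] ℝ) (b : ι → ℝ) {β : ℝ} {x y : E}
    (hx : x ∈ C) (hy : y ∈ C) (hmin : IsMinOn (fun z => ψ z + β / 2 * ∑ i, (L i z - b i) ^ 2) C x) :
    ψ x + β / 2 * ∑ i, (L i x - b i) ^ 2 + β / 4 * ∑ i, L i (x - y) ^ 2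
      ≤ ψ y + β / 2 * ∑ i, (L i y - b i) ^ 2 := by
  have half : (0 : ℝ) ≤ 1 / 2 := by norm_num
  have hψmid := hψ.2 hx hy half half (by norm_num)
  have hqmid : ∑ i, (L i ((1 / 2 : ℝ) • x + (1 / 2 : ℝ) • y) - b i) ^ 2
      = 1 / 2 * ∑ i, (L i x - b i) ^ 2 + 1 / 2 * ∑ i, (L i y - b i) ^ 2
        - 1 / 4 * ∑ i, L i (x - y) ^ 2 := by
    simp only [Finset.mul_sum, ← Finset.sum_add_distrib, ← Finset.sum_sub_distrib, map_add,
      map_sub, map_smul, smul_eq_mul]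
    exact Finset.sum_congr rfl fun i _ => by ring
  have hmid := isMinOn_iff.1 hmin _ (hψ.1 hx hy half half (by norm_num))
  rw [hqmid] at hmid
  simp only [smul_eq_mul] at hψmid
  linarith

theorem convexOn_l1Norm {C : Set (Matrix (Fin N) (Fin N) ℝ)} (hC : Convex ℝ C) :
    ConvexOn ℝ C l1Norm := by
  refine ⟨hC, fun A _ B _ a b ha hb _ => ?_⟩
  simp only [l1Norm, smul_eq_mul, Finset.mul_sum, ← Finset.sum_add_distrib, Matrix.add_apply,
    Matrix.smul_apply]
  gcongr with i _ j
  exact (abs_add_le _ _).trans_eq (by rw [abs_mul, abs_mul, abs_of_nonneg ha, abs_of_nonneg hb])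

theorem concaveOn_sum_log :
    ConcaveOn ℝ (Set.univ.pi fun _ : Fin N => Set.Ioi (0 : ℝ)) fun l => ∑ j, Real.log (l j) := by
  refine ⟨convex_pi fun _ _ => convex_Ioi 0, fun x hx y hy a b ha hb hab => ?_⟩
  simp only [smul_eq_mul, Finset.mul_sum, ← Finset.sum_add_distrib]
  exact Finset.sum_le_sum fun i _ =>
    strictConcaveOn_log_Ioi.concaveOn.2 (hx i trivial) (hy i trivial) ha hb hab

theorem log_det_diagonal {l : Fin N → ℝ} (hl : ∀ i, 0 < l i) :
    Real.log (det (diagonal l)) = ∑ j, Real.log (l j) := by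
  rw [det_diagonal, Real.log_prod fun i _ => (hl i).ne']

namespace Data

section Descent

variable (P : Data N M K) {𝒮 : Set (Matrix (Fin N) (Fin N) ℝ)}

theorem convex_spectra (hc : ConcaveOn ℝ (Set.Ioi 0) P.g) :
    Convex ℝ (P.spectra (N := N)) := by
  convert (concaveOn_cg (n := N) hc).convex_ge (cg P.g P.lref - P.δ) using 1
  ext l
  simp [spectra]

theorem spectra_subset_pi : P.spectra (N := N) ⊆ Set.univ.pi fun _ => Set.Ioi (0 : ℝ) :=
  fun _ hl i _ => hl.1 i

theorem IsExactStep1.quadratic_growth (hα : 0 ≤ P.α) (hC : Convex ℝ 𝒮) {x : Point N}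
    {S S' : Matrix (Fin N) (Fin N) ℝ} (hS' : P.IsExactStep1 𝒮 x S') (hS : S ∈ 𝒮) :
    P.step1Obj x.2.1 x.2.2 S' + P.β / 4 * frobSq (S' - S) ≤ P.step1Obj x.2.1 x.2.2 S := by
  have hψ : ConvexOn ℝ 𝒮 (fun S => trace (empCov P.X * S) + P.α * l1Norm S) :=
    ConvexOn.add ⟨hC, fun A _ B _ a b _ _ _ => by simp [Matrix.mul_add, trace_add]⟩
      ((convexOn_l1Norm hC).smul hα)
  have h := quadratic_growth_of_isMinOn hψ (fun p : Fin N × Fin N => entryLinearMap ℝ ℝ p.1 p.2)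
    (fun p => (x.2.1 * diagonal x.2.2 * x.2.1ᵀ) p.1 p.2) (β := P.β) hS'.1 hS
  simp only [entryLinearMap_apply, ← Matrix.sub_apply, Fintype.sum_prod_type] at h
  exact h hS'.2

theorem IsStep3.quadratic_growth (hc : ConcaveOn ℝ (Set.Ioi 0) P.g)
    {S V : Matrix (Fin N) (Fin N) ℝ} {l₀ l l' : Fin N → ℝ} (hl' : P.IsStep3 S V l₀ l')
    (hl : l ∈ P.spectra) :
    P.step3Obj S V l₀ l' + P.β / 4 * ∑ j, (l' j - l j) ^ 2 ≤ P.step3Obj S V l₀ l := by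
  have hψ : ConvexOn ℝ P.spectra fun l => -∑ j, Real.log (l j) + P.γ * majorizer P.g l l₀ :=
    (concaveOn_sum_log.subset P.spectra_subset_pi (P.convex_spectra hc)).neg.add
      ⟨P.convex_spectra hc, fun x _ y _ a b _ _ _ => by
        simp only [majorizer, map_add, map_smul, smul_eq_mul]
        exact le_of_eq (by ring)⟩
  have h := quadratic_growth_of_isMinOn hψ (fun j => LinearMap.proj j)
    (fun j => (Vᵀ * S * V) j j) (β := P.β) hl'.1 hl
  simp only [LinearMap.proj_apply, Pi.sub_apply,
    add_right_comm _ (P.γ * majorizer _ _ _) (_ / 2 * _)] at h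
  exact h hl'.2

theorem objective_eq_step1Obj {x : Point N} (hl : ∀ i, 0 < x.2.2 i) :
    P.objective x = P.step1Obj x.2.1 x.2.2 x.1 - ∑ j, Real.log (x.2.2 j)
      + P.γ * cg P.g x.2.2 := by
  simp only [objective, step1Obj, log_det_diagonal hl]; ring

theorem IsStep2.frobSq_le {S V V' : Matrix (Fin N) (Fin N) ℝ} {l : Fin N → ℝ} (hV : Vᵀ * V = 1)
    (hV' : IsStep2 S l V') :
    frobSq (S - V' * diagonal l * V'ᵀ) ≤ frobSq (S - V * diagonal l * Vᵀ) := by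
  rw [frobSq_sub_conj_diagonal S l hV, frobSq_sub_conj_diagonal S l hV'.1]
  linarith [isMaxOn_iff.1 hV'.2 V hV]

theorem IsStep2.step1Obj_le (hβ : 0 ≤ P.β) {S V V' : Matrix (Fin N) (Fin N) ℝ} {l : Fin N → ℝ}
    (hV : Vᵀ * V = 1) (hV' : IsStep2 S l V') : P.step1Obj V' l S ≤ P.step1Obj V l S := by
  unfold step1Obj
  gcongr
  exact hV'.frobSq_le hV

theorem step1Obj_eq_step3Obj {S V : Matrix (Fin N) (Fin N) ℝ} (hV : Vᵀ * V = 1)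
    (l₀ l : Fin N → ℝ) :
    P.step1Obj V l S = P.step3Obj S V l₀ l + ∑ j, Real.log (l j) - P.γ * majorizer P.g l l₀
      + P.step1Obj V (diag (Vᵀ * S * V)) S := by
  simp only [step1Obj, step3Obj, frobSq_sub_conj_diagonal_eq_add_sum_sq S l hV]; ring

theorem objective_add_le_of_sweep (hβ : 0 ≤ P.β) (hγ : 0 ≤ P.γ)
    (hc : ConcaveOn ℝ (Set.Ioi 0) P.g) (hd : DifferentiableOn ℝ P.g (Set.Ioi 0)) {x y : Point N}
    (hx : x ∈ P.feasible 𝒮)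
    (h1 : P.step1Obj x.2.1 x.2.2 y.1 + P.β / 4 * frobSq (y.1 - x.1)
      ≤ P.step1Obj x.2.1 x.2.2 x.1)
    (h2 : IsStep2 y.1 x.2.2 y.2.1) (h3 : P.IsStep3 y.1 y.2.1 x.2.2 y.2.2) :
    P.objective y + P.β / 4 * (frobSq (y.1 - x.1) + ∑ j, (y.2.2 j - x.2.2 j) ^ 2)
      ≤ P.objective x := by
  obtain ⟨-, hV, hl⟩ := hx
  have hStep2 := h2.step1Obj_le P hβ hV
  have hStep3 := h3.quadratic_growth P hc hl
  have hMajorizer := mul_le_mul_of_nonneg_left (cg_le_majorizer hc h3.1.1 hl.1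
    fun i => hd.differentiableAt (Ioi_mem_nhds (hl.1 i))) hγ
  rw [P.step1Obj_eq_step3Obj h2.1 x.2.2] at hStep2
  rw [P.objective_eq_step1Obj hl.1, P.objective_eq_step1Obj h3.1.1,
    P.step1Obj_eq_step3Obj h2.1 x.2.2]
  linarith

end Descent

end Data

section Coercivity

theorem orthogonal_abs_apply_le_one {V : Matrix (Fin N) (Fin N) ℝ} (hV : Vᵀ * V = 1)
    (i j : Fin N) : |V i j| ≤ 1 :=
  entry_norm_bound_of_unitary (mem_unitaryGroup_iff'.2 (by simpa [star_eq_conjTranspose])) i j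

variable (S : Matrix (Fin N) (Fin N) ℝ)

theorem l1Norm_nonneg : 0 ≤ l1Norm S := by
  unfold l1Norm; positivity

theorem abs_apply_le_l1Norm (i j : Fin N) : |S i j| ≤ l1Norm S :=
  (Finset.single_le_sum (f := fun j => |S i j|) (fun _ _ => abs_nonneg _)
    (Finset.mem_univ j)).trans
  (Finset.single_le_sum (f := fun i => ∑ j, |S i j|) (fun _ _ => by positivity)
    (Finset.mem_univ i))

theorem conj_diag_le_l1Norm {V : Matrix (Fin N) (Fin N) ℝ} (hV : Vᵀ * V = 1) (k : Fin N) :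
    (Vᵀ * S * V) k k ≤ l1Norm S := by
  calc (Vᵀ * S * V) k k = ∑ i, ∑ j, V i k * S i j * V j k := by
        simp only [mul_apply, transpose_apply, Finset.sum_mul]
        exact Finset.sum_comm
    _ ≤ l1Norm S := by
        unfold l1Norm
        gcongr with i _ j
        calc V i k * S i j * V j k ≤ |V i k| * |S i j| * |V j k| := by
              rw [← abs_mul, ← abs_mul]; exact le_abs_self _
          _ ≤ 1 * |S i j| * 1 := by gcongr <;> exact orthogonal_abs_apply_le_one hV _ k
          _ = |S i j| := by ring

theorem posSemidef_empCov (X : Matrix (Fin N) (Fin M) ℝ) : (empCov X).PosSemidef :=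
  (posSemidef_sum _ fun m _ => by simpa using posSemidef_vecMulVec_self_star fun i => X i m).smul
    (by positivity)

theorem posSemidef_trace_mul_conj_diagonal_nonneg {C : Matrix (Fin N) (Fin N) ℝ}
    (hC : C.PosSemidef) (V : Matrix (Fin N) (Fin N) ℝ) {l : Fin N → ℝ} (hl : ∀ i, 0 ≤ l i) :
    0 ≤ trace (C * (V * diagonal l * Vᵀ)) := by
  have hconj : (Vᵀ * C * V).PosSemidef := by simpa using hC.conjTranspose_mul_mul_same V
  have h : trace (C * (V * diagonal l * Vᵀ)) = trace (Vᵀ * C * V * diagonal l) := by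
    rw [← trace_transpose_mul_conj_diagonal, ← conjTranspose_eq_transpose_of_trivial C,
      hC.isHermitian.eq]
  rw [h, trace_mul_diagonal]
  exact Finset.sum_nonneg fun j _ => mul_nonneg hconj.diag_nonneg (hl j)

theorem mul_le_young {b : ℝ} (hb : 0 < b) (a x : ℝ) : a * x ≤ b / 8 * x ^ 2 + 2 / b * a ^ 2 := by
  have h : b / 8 * x ^ 2 + 2 / b * a ^ 2 - a * x = b / 8 * (x - 4 / b * a) ^ 2 := by
    field_simp; ring
  have : 0 ≤ b / 8 * (x - 4 / b * a) ^ 2 := by positivity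
  linarith

theorem neg_trace_transpose_mul_le {b : ℝ} (hb : 0 < b) (A B : Matrix (Fin N) (Fin N) ℝ) :
    -trace (Aᵀ * B) ≤ b / 8 * frobSq B + 2 / b * frobSq A := by
  simp only [trace_transpose_mul_eq_sum, frobSq, Finset.mul_sum, ← Finset.sum_add_distrib,
    ← Finset.sum_neg_distrib]
  gcongr with i _ j
  simpa using mul_le_young hb (-A i j) (B i j)

theorem one_add_log_le {a u : ℝ} (ha : 0 < a) (hu : 0 < u) :
    1 + Real.log a ≤ a * u - Real.log u := by
  have := Real.log_le_sub_one_of_pos (mul_pos ha hu)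
  rw [Real.log_mul ha.ne' hu.ne'] at this
  linarith

theorem mem_Icc_of_mul_sub_log_le {a u D : ℝ} (ha : 0 < a) (hu : 0 < u)
    (h : a * u - Real.log u ≤ D) :
    u ∈ Set.Icc (Real.exp (-D)) (2 * (D - (1 + Real.log (a / 2))) / a) := by
  constructor
  · rw [← Real.le_log_iff_exp_le hu]
    linarith [mul_pos ha hu]
  · rw [le_div_iff₀ ha]
    linarith [one_add_log_le (half_pos ha) hu]

namespace Data

variable (P : Data N M K) {S}

theorem le_trace_empCov_mul (hβ : 0 < P.β) {V : Matrix (Fin N) (Fin N) ℝ} {l : Fin N → ℝ}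
    (hl : ∀ i, 0 ≤ l i) :
    -(P.β / 8 * frobSq (S - V * diagonal l * Vᵀ) + 2 / P.β * frobSq (empCov P.X))
      ≤ trace (empCov P.X * S) := by
  have hC := posSemidef_empCov P.X
  have hconj := posSemidef_trace_mul_conj_diagonal_nonneg hC V hl
  have hresidual := neg_trace_transpose_mul_le hβ (empCov P.X) (S - V * diagonal l * Vᵀ)
  rw [← conjTranspose_eq_transpose_of_trivial (empCov P.X), hC.isHermitian.eq, Matrix.mul_sub,
    trace_sub] at hresidual
  linarith

theorem mul_sum_le_l1Norm (hα : 0 ≤ P.α) (hβ : 0 < P.β) {V : Matrix (Fin N) (Fin N) ℝ}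
    {l : Fin N → ℝ} (hV : Vᵀ * V = 1) {a : ℝ} (ha : a = P.α / (2 * (N + 1))) :
    ∑ k, a * l k ≤ P.α / 2 * l1Norm S + P.β / 8 * frobSq (S - V * diagonal l * Vᵀ)
      + N * (2 / P.β * a ^ 2) := by
  have ha₀ : 0 ≤ a := by rw [ha]; positivity
  have hNa : N * a ≤ P.α / 2 := by
    rw [ha, mul_div_assoc', div_le_div_iff₀ (by positivity) (by positivity)]
    nlinarith
  have hterm : ∀ k, a * l k ≤ a * l1Norm S + P.β / 8 * (l k - (Vᵀ * S * V) k k) ^ 2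
      + 2 / P.β * a ^ 2 := fun k => by
    have := mul_le_young hβ a (l k - (Vᵀ * S * V) k k)
    have := mul_le_mul_of_nonneg_left (conj_diag_le_l1Norm S hV k) ha₀
    linarith
  calc ∑ k, a * l k
      ≤ ∑ k, (a * l1Norm S + P.β / 8 * (l k - (Vᵀ * S * V) k k) ^ 2 + 2 / P.β * a ^ 2) :=
        Finset.sum_le_sum fun k _ => hterm k
    _ = N * a * l1Norm S + P.β / 8 * ∑ k, (l k - (Vᵀ * S * V) k k) ^ 2
          + N * (2 / P.β * a ^ 2) := by
        simp only [Finset.sum_add_distrib, ← Finset.mul_sum, Finset.sum_const, Finset.card_univ,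
          Fintype.card_fin, nsmul_eq_mul]
        ring
    _ ≤ _ := by
        gcongr
        · exact l1Norm_nonneg S
        · rw [frobSq_sub_conj_diagonal_eq_add_sum_sq S l hV]
          exact le_add_of_nonneg_left (frobSq_nonneg _)

/- Half of the `ℓ¹` penalty is traded for linear growth in `l`: the quadratic coupling keeps `l`
close to the diagonal of `Vᵀ S V`, which the `ℓ¹` norm of `S` bounds. -/
theorem exists_coercive_bound (hα : 0 < P.α) (hβ : 0 < P.β) (hγ : 0 ≤ P.γ) :
    ∃ a > 0, ∃ C : ℝ, ∀ 𝒮 : Set (Matrix (Fin N) (Fin N) ℝ), ∀ x ∈ P.feasible 𝒮,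
      P.α / 2 * l1Norm x.1 + ∑ k, (a * x.2.2 k - Real.log (x.2.2 k)) ≤ P.objective x + C := by
  obtain ⟨a, ha⟩ : ∃ a, a = P.α / (2 * (N + 1)) := ⟨_, rfl⟩
  refine ⟨a, by rw [ha]; positivity, 2 / P.β * frobSq (empCov P.X) + N * (2 / P.β * a ^ 2)
    - P.γ * (cg P.g P.lref - P.δ), ?_⟩
  rintro 𝒮 ⟨S, V, l⟩ ⟨-, hV : Vᵀ * V = 1, hl : ∀ i, 0 < l i, hcg : cg P.g l ≥ _⟩
  have htrace := P.le_trace_empCov_mul (S := S) (V := V) hβ fun i => (hl i).le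
  have hspec := P.mul_sum_le_l1Norm (S := S) (l := l) hα.le hβ hV ha
  have hpenalty := mul_le_mul_of_nonneg_left hcg.le hγ
  have hfrob := mul_nonneg hβ.le (frobSq_nonneg (S - V * diagonal l * Vᵀ))
  rw [P.objective_eq_step1Obj hl, Finset.sum_sub_distrib]
  simp only [step1Obj]
  linarith

theorem exists_compact_sublevel (hα : 0 < P.α) (hβ : 0 < P.β) (hγ : 0 ≤ P.γ) (B : ℝ) :
    ∃ Q : Set (Point N), IsCompact Q ∧ (∀ x ∈ Q, ∀ i, 0 < x.2.2 i) ∧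
      ∀ 𝒮 : Set (Matrix (Fin N) (Fin N) ℝ), ∀ x ∈ P.feasible 𝒮, P.objective x ≤ B → x ∈ Q := by
  obtain ⟨a, ha, C, hcoercive⟩ := P.exists_coercive_bound hα hβ hγ
  obtain ⟨m, hm⟩ : ∃ m, m = 1 + Real.log a := ⟨_, rfl⟩
  obtain ⟨D, hD⟩ : ∃ D, D = B + C - N * m := ⟨_, rfl⟩
  let box (r : ℝ) : Set (Matrix (Fin N) (Fin N) ℝ) :=
    Set.univ.pi fun _ => Set.univ.pi fun _ => Set.Icc (-r) r
  let spectralBox : Set (Fin N → ℝ) := Set.univ.pi fun _ =>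
    Set.Icc (Real.exp (-(D + m))) (2 * (D + m - (1 + Real.log (a / 2))) / a)
  have isCompact_box : ∀ r, IsCompact (box r) := fun r =>
    isCompact_univ_pi fun _ => isCompact_univ_pi fun _ => isCompact_Icc
  refine ⟨box (2 * D / P.α) ×ˢ box 1 ×ˢ spectralBox, (isCompact_box _).prod
    ((isCompact_box _).prod (isCompact_univ_pi fun _ => isCompact_Icc)),
    fun x hx i => (Real.exp_pos _).trans_le (hx.2.2 i trivial).1, fun 𝒮 x hx hxB => ?_⟩
  have hl := hx.2.2.1
  have hterm : ∀ k, 0 ≤ a * x.2.2 k - Real.log (x.2.2 k) - m := fun k =>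
    sub_nonneg.2 (hm ▸ one_add_log_le ha (hl k))
  have hsum : P.α / 2 * l1Norm x.1 + ∑ k, (a * x.2.2 k - Real.log (x.2.2 k) - m) ≤ D := by
    rw [Finset.sum_sub_distrib, Finset.sum_const, Finset.card_univ, Fintype.card_fin,
      nsmul_eq_mul]
    linarith [hcoercive 𝒮 x hx]
  have hl1 : l1Norm x.1 ≤ 2 * D / P.α := by
    rw [le_div_iff₀ hα]
    linarith [Finset.sum_nonneg fun k (_ : k ∈ Finset.univ) => hterm k]
  have hlog : ∀ k, a * x.2.2 k - Real.log (x.2.2 k) ≤ D + m := fun k => by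
    linarith [Finset.single_le_sum (fun k _ => hterm k) (Finset.mem_univ k),
      mul_nonneg (half_pos hα).le (l1Norm_nonneg x.1)]
  exact ⟨fun i _ j _ => abs_le.1 ((abs_apply_le_l1Norm x.1 i j).trans hl1),
    fun i _ j _ => abs_le.1 (orthogonal_abs_apply_le_one hx.2.1 i j),
    fun k _ => mem_Icc_of_mul_sub_log_le ha (hl k) (hlog k)⟩

end Data

end Coercivity

section NonsmoothFermat

theorem exists_hasDerivWithinAt_Ici_of_convexOn {E : Type*} [AddCommGroup E] [Module ℝ E]
    {p : E → ℝ} (hp : ConvexOn ℝ Set.univ p) (x d : E) :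
    ∃ r, HasDerivWithinAt (fun h : ℝ => p (x + h • d)) r (Set.Ici 0) 0 := by
  have hline : ConvexOn ℝ Set.univ fun h : ℝ => p (x + h • d) := by
    simpa [Function.comp_def, AffineMap.lineMap_apply, add_comm] using
      hp.comp_affineMap (AffineMap.lineMap (k := ℝ) x (x + d))
  exact ⟨_, (hline.hasDerivWithinAt_rightDeriv_of_mem_interior (by simp)).Ici_of_Ioi⟩

variable {E : Type*} [NormedAddCommGroup E] [NormedSpace ℝ E]

/- With `hₙ = 1 / cₙ`, the Lipschitz bound replaces `p (x + eₙ)` by `p (x + hₙ d)` at the cost of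
`K ‖cₙ eₙ - d‖`. -/
theorem tendsto_smul_sub_of_lipschitzOnWith {p : E → ℝ} {x d : E} {r : ℝ} {K : NNReal} {s : Set E}
    (hs : s ∈ 𝓝 x) (hp : LipschitzOnWith K p s) (hd : d ≠ 0)
    (hr : HasDerivWithinAt (fun h : ℝ => p (x + h • d)) r (Set.Ici 0) 0) {ι : Type*} {F : Filter ι}
    {c : ι → ℝ} {e : ι → E} (hc : ∀ n, 0 ≤ c n) (he : Tendsto e F (𝓝 0))
    (hce : Tendsto (fun n => c n • e n) F (𝓝 d)) :
    Tendsto (fun n => c n * (p (x + e n) - p x)) F (𝓝 r) := by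
  have c_pos : ∀ᶠ n in F, 0 < c n := (hce.eventually_ne hd).mono fun n hn =>
    (hc n).lt_of_ne' fun h => hn (by simp [h])
  have inv_tendsto : Tendsto (fun n => (c n)⁻¹) F (𝓝 0) := by
    have h := he.norm.div hce.norm (norm_ne_zero_iff.2 hd)
    rw [norm_zero, zero_div] at h
    refine h.congr' ?_
    filter_upwards [c_pos, hce.eventually_ne hd] with n hn hne
    have : ‖e n‖ ≠ 0 := norm_ne_zero_iff.2 fun h => hne (by simp [h])
    rw [Pi.div_apply, norm_smul, Real.norm_of_nonneg hn.le]
    field_simp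
  have line_tendsto : Tendsto (fun n => c n * (p (x + (c n)⁻¹ • d) - p x)) F (𝓝 r) := by
    rw [hasDerivWithinAt_iff_tendsto_slope, Set.Ici_sdiff_left] at hr
    refine (hr.comp (tendsto_nhdsWithin_iff.2
      ⟨inv_tendsto, c_pos.mono fun n hn => inv_pos.2 hn⟩)).congr fun n => ?_
    simp [slope_def_field, div_eq_inv_mul]
  have error_tendsto : Tendsto (fun n => c n * (p (x + e n) - p (x + (c n)⁻¹ • d))) F (𝓝 0) := by
    have mem_s : ∀ {u : ι → E}, Tendsto u F (𝓝 0) → ∀ᶠ n in F, x + u n ∈ s := fun hu =>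
      (by simpa using hu.const_add x : Tendsto _ F (𝓝 x)).eventually hs
    refine squeeze_zero_norm' (a := fun n => K * ‖c n • e n - d‖) ?_ ?_
    · filter_upwards [c_pos, mem_s he, mem_s (by simpa using inv_tendsto.smul_const d)]
        with n hn h₁ h₂
      have hsub : c n • e n - d = c n • (x + e n - (x + (c n)⁻¹ • d)) := by
        rw [add_sub_add_left_eq_sub, smul_sub, smul_inv_smul₀ hn.ne']
      rw [hsub, norm_mul, norm_smul, mul_left_comm]
      gcongr
      exact hp.norm_sub_le h₁ h₂
    · simpa using ((hce.sub_const d).norm.const_mul (K : ℝ))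
  simpa [← mul_add] using error_tendsto.add line_tendsto

theorem nonneg_of_isMinOn_of_mem_posTangentConeAt {p q : E → ℝ} {q' : E →L[ℝ] ℝ} {C : Set E}
    {x d : E} {r : ℝ} (hp : LocallyLipschitz p) (hq : HasFDerivAt q q' x)
    (hmin : IsMinOn (fun y => p y + q y) C x) (hd : d ∈ posTangentConeAt C x)
    (hr : HasDerivWithinAt (fun h : ℝ => p (x + h • d)) r (Set.Ici 0) 0) : 0 ≤ r + q' d := by
  rcases eq_or_ne d 0 with rfl | hd0
  · simp only [smul_zero] at hr
    rw [map_zero, add_zero, (uniqueDiffWithinAt_Ici (0 : ℝ)).eq_deriv _ hr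
      (hasDerivWithinAt_const _ _ _)]
  · obtain ⟨K, s, hs, hK⟩ := hp x
    obtain ⟨ι, F, hF, c, e, he, hmem, hce⟩ := exists_fun_of_mem_tangentConeAt hd
    have hce : Tendsto (fun n => (c n : ℝ) • e n) F (𝓝 d) := hce
    refine ge_of_tendsto ((tendsto_smul_sub_of_lipschitzOnWith hs hK hd0 hr
      (fun n => (c n).coe_nonneg) he hce).add
      (hq.hasFDerivWithinAt.lim (s := Set.univ) he (by simp) hce)) ?_
    filter_upwards [hmem] with n hn
    have := mul_nonneg (c n).coe_nonneg (sub_nonneg.2 (isMinOn_iff.1 hmin _ hn))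
    simp only [smul_eq_mul]
    linarith

theorem hasFDerivAt_sum_partial {E₁ E₂ E₃ F : Type*} [NormedAddCommGroup E₁] [NormedSpace ℝ E₁]
    [NormedAddCommGroup E₂] [NormedSpace ℝ E₂] [NormedAddCommGroup E₃] [NormedSpace ℝ E₃]
    [NormedAddCommGroup F] [NormedSpace ℝ F] {q : E₁ × E₂ × E₃ → F} {x : E₁ × E₂ × E₃}
    {q' : E₁ × E₂ × E₃ →L[ℝ] F} (hq : HasFDerivAt q q' x) :
    HasFDerivAt (fun y : E₁ × E₂ × E₃ =>
      q (y.1, x.2.1, x.2.2) + q (x.1, y.2.1, x.2.2) + q (x.1, x.2.1, y.2.2)) q' x := by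
  have hfst : HasFDerivAt Prod.fst (ContinuousLinearMap.fst ℝ E₁ (E₂ × E₃)) x := hasFDerivAt_fst
  have hsnd : HasFDerivAt Prod.snd (ContinuousLinearMap.snd ℝ E₁ (E₂ × E₃)) x := hasFDerivAt_snd
  have h₁ := hq.comp (f := fun y : E₁ × E₂ × E₃ => (y.1, x.2.1, x.2.2)) x
    (hfst.prodMk (hasFDerivAt_const (x.2.1, x.2.2) x))
  have h₂ := hq.comp (f := fun y : E₁ × E₂ × E₃ => (x.1, y.2.1, x.2.2)) x
    ((hasFDerivAt_const x.1 x).prodMk (hsnd.fst.prodMk (hasFDerivAt_const x.2.2 x)))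
  have h₃ := hq.comp (f := fun y : E₁ × E₂ × E₃ => (x.1, x.2.1, y.2.2)) x
    ((hasFDerivAt_const x.1 x).prodMk ((hasFDerivAt_const x.2.1 x).prodMk hsnd.snd))
  refine ((h₁.add h₂).add h₃).congr_fderiv (ContinuousLinearMap.ext fun d => ?_)
  change q' (d.1, 0) + q' (0, d.2.1, 0) + q' (0, 0, d.2.2) = q' d
  rw [← map_add, ← map_add]
  congr 1
  ext <;> simp

end NonsmoothFermat

section Stationarity

attribute [local instance] Matrix.normedAddCommGroup Matrix.normedSpace

namespace Data

variable (P : Data N M K) {𝒮 : Set (Matrix (Fin N) (Fin N) ℝ)} {x : Point N}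

/-- The differentiable part of the objective that couples the three blocks. -/
noncomputable def coupling (x : Point N) : ℝ :=
  trace (empCov P.X * x.1) - Real.log (det (diagonal x.2.2))
    + P.β / 2 * frobSq (x.1 - x.2.1 * diagonal x.2.2 * x.2.1ᵀ)

/-- A fixed point of the sweep: each block solves its own subproblem, the two other blocks being
kept at their current values. -/
def IsBlockOptimal (𝒮 : Set (Matrix (Fin N) (Fin N) ℝ)) (x : Point N) : Prop :=
  P.IsExactStep1 𝒮 x x.1 ∧ IsStep2 x.1 x.2.2 x.2.1 ∧ P.IsStep3 x.1 x.2.1 x.2.2 x.2.2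

theorem differentiableAt_coupling (hl : ∀ i, 0 < x.2.2 i) : DifferentiableAt ℝ P.coupling x := by
  have dS : ∀ i j, DifferentiableAt ℝ (fun y : Point N => y.1 i j) x := fun i j =>
    differentiableAt_pi.1 (differentiableAt_pi.1 (differentiableAt_fst (p := x)) i) j
  have dV : ∀ i j, DifferentiableAt ℝ (fun y : Point N => y.2.1 i j) x := fun i j =>
    differentiableAt_pi.1 (differentiableAt_pi.1 (differentiableAt_snd (p := x)).fst i) j
  have dl : ∀ i, DifferentiableAt ℝ (fun y : Point N => y.2.2 i) x := fun i =>
    differentiableAt_pi.1 (differentiableAt_snd (p := x)).snd i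
  have entrywise : P.coupling = fun y : Point N => ∑ i, ∑ j, empCov P.X i j * y.1 j i
      - Real.log (∏ i, y.2.2 i)
      + P.β / 2 * ∑ i, ∑ j, (y.1 i j - ∑ k, y.2.1 i k * y.2.2 k * y.2.1 j k) ^ 2 := by
    funext y
    simp only [coupling, det_diagonal, frobSq, Matrix.sub_apply, trace, diag_apply,
      Matrix.mul_apply (N := y.2.1ᵀ), Matrix.mul_apply (M := empCov P.X), mul_diagonal,
      transpose_apply]
  have prod_ne_zero : ∏ i, x.2.2 i ≠ 0 := Finset.prod_ne_zero_iff.2 fun i _ => (hl i).ne'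
  rw [entrywise]
  fun_prop (disch := assumption)

theorem objective_eq_coupling (y : Point N) :
    P.objective y = P.α * l1Norm y.1 + (P.coupling y + P.γ * cg P.g y.2.2) := by
  simp only [objective, coupling]; ring

/- Around a block-optimal point the sum of the three partial couplings, with `c_g` linearized, is
minimal; and it has the same derivative there as the objective. -/
theorem IsBlockOptimal.isMinOn_surrogate (hβ : 0 ≤ P.β) (hx : P.IsBlockOptimal 𝒮 x) :
    IsMinOn (fun y => P.α * l1Norm y.1 + ((P.coupling (y.1, x.2.1, x.2.2)
      + P.coupling (x.1, y.2.1, x.2.2) + P.coupling (x.1, x.2.1, y.2.2))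
      + P.γ * majorizer P.g y.2.2 x.2.2)) (P.feasible 𝒮) x := by
  obtain ⟨⟨-, h1⟩, h2, hl, h3⟩ := hx
  refine isMinOn_iff.2 fun y ⟨hyS, hyV, hyl⟩ => ?_
  have hS := isMinOn_iff.1 h1 y.1 hyS
  have hV := h2.step1Obj_le P hβ hyV
  have hL := isMinOn_iff.1 h3 y.2.2 hyl
  have hLx := P.step1Obj_eq_step3Obj (S := x.1) h2.1 x.2.2 x.2.2
  have hLy := P.step1Obj_eq_step3Obj (S := x.1) h2.1 x.2.2 y.2.2
  simp only [coupling, log_det_diagonal hl.1, log_det_diagonal hyl.1]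
  simp only [step1Obj] at hS hV hLx hLy
  linarith

theorem IsBlockOptimal.mem_stationary (hα : 0 ≤ P.α) (hβ : 0 ≤ P.β)
    (hd : DifferentiableOn ℝ P.g (Set.Ioi 0)) (hx : P.IsBlockOptimal 𝒮 x) :
    x ∈ P.stationary 𝒮 := by
  refine ⟨⟨hx.1.1, hx.2.1.1, hx.2.2.1⟩, fun d hdx => ?_⟩
  have hl := hx.2.2.1.1
  have hproj : HasFDerivAt (fun y : Point N => y.2.2) ((ContinuousLinearMap.snd ℝ _ _).comp
    (ContinuousLinearMap.snd ℝ _ _)) x := HasFDerivAt.snd (hasFDerivAt_snd (p := x))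
  have hcoupling := (P.differentiableAt_coupling hl).hasFDerivAt
  have hcg := (hasFDerivAt_cg fun i =>
    hd.differentiableAt (Ioi_mem_nhds (hl i))).differentiableAt.hasFDerivAt
  have hsmooth := hcoupling.add ((hcg.comp x hproj).const_mul P.γ)
  have hsurrogate := (hasFDerivAt_sum_partial hcoupling).add
    (((fderiv ℝ (cg P.g) x.2.2).hasFDerivAt.comp x hproj).const_mul P.γ)
  have hconvex : ConvexOn ℝ Set.univ fun y : Point N => P.α * l1Norm y.1 :=
    ((convexOn_l1Norm convex_univ).comp_linearMap (LinearMap.fst ℝ _ _)).smul hα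
  have hline : HasDerivAt (fun h : ℝ => x + h • d) d 0 :=
    (((hasDerivAt_id (0 : ℝ)).smul_const d).const_add x).congr_deriv (one_smul ℝ d)
  obtain ⟨r, hr⟩ := exists_hasDerivWithinAt_Ici_of_convexOn hconvex x d
  refine ⟨_, nonneg_of_isMinOn_of_mem_posTangentConeAt hconvex.locallyLipschitz hsurrogate
    (hx.isMinOn_surrogate P hβ) hdx hr, ?_⟩
  simp only [objective_eq_coupling]
  exact hr.add (HasFDerivAt.comp_hasDerivAt_of_eq (0 : ℝ) hsmooth hline (by simp)).hasDerivWithinAt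

end Data

end Stationarity

section Convergence

theorem continuous_frobSq : Continuous (frobSq : Matrix (Fin N) (Fin N) ℝ → ℝ) :=
  continuous_finsetSum _ fun i _ => continuous_finsetSum _ fun j _ =>
    (continuous_id.matrix_elem i j).pow 2

theorem continuous_l1Norm : Continuous (l1Norm : Matrix (Fin N) (Fin N) ℝ → ℝ) :=
  continuous_finsetSum _ fun i _ => continuous_finsetSum _ fun j _ =>
    (continuous_id.matrix_elem i j).abs

theorem continuous_pointDist (y : Point N) : Continuous fun x => pointDist x y :=
  Real.continuous_sqrt.comp (((continuous_frobSq.comp (continuous_fst.sub continuous_const)).add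
    (continuous_frobSq.comp (continuous_snd.fst.sub continuous_const))).add
    (continuous_finsetSum _ fun i _ =>
      (((continuous_apply i).comp continuous_snd.snd).sub continuous_const).pow 2))

theorem pointDist_self (y : Point N) : pointDist y y = 0 := by
  simp [pointDist, frobSq]

theorem tendsto_zero_of_sum_sq {ι κ : Type*} [Fintype κ] {F : Filter ι} {u : ι → κ → ℝ}
    (h : Tendsto (fun t => ∑ k, u t k ^ 2) F (𝓝 0)) : Tendsto u F (𝓝 0) := by
  refine tendsto_pi_nhds.2 fun k => squeeze_zero_norm (fun t => ?_)
    (by simpa using (Real.continuous_sqrt.tendsto 0).comp h)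
  exact Real.abs_le_sqrt
    (Finset.single_le_sum (f := fun k => u t k ^ 2) (fun _ _ => sq_nonneg _) (Finset.mem_univ k))

theorem tendsto_zero_of_frobSq {ι : Type*} {F : Filter ι} {A : ι → Matrix (Fin N) (Fin N) ℝ}
    (h : Tendsto (fun t => frobSq (A t)) F (𝓝 0)) : Tendsto A F (𝓝 0) := by
  have hentry := tendsto_zero_of_sum_sq (u := fun t (p : Fin N × Fin N) => A t p.1 p.2)
    (by simpa only [Fintype.sum_prod_type, frobSq] using h)
  exact tendsto_pi_nhds.2 fun i => tendsto_pi_nhds.2 fun j => tendsto_pi_nhds.1 hentry (i, j)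

theorem mapClusterPt_succ_iff {X : Type*} [TopologicalSpace X] {x : ℕ → X} {y : X} :
    MapClusterPt y atTop (fun t => x (t + 1)) ↔ MapClusterPt y atTop x := by
  unfold MapClusterPt
  conv_rhs => rw [← map_add_atTop_eq_nat 1, Filter.map_map]
  rfl

theorem convergesToSet_of_succ {x : ℕ → Point N} {Y : Set (Point N)}
    (h : ConvergesToSet (fun t => x (t + 1)) Y) : ConvergesToSet x Y := by
  simp only [ConvergesToSet, mapClusterPt_succ_iff] at h
  exact ⟨fun ε hε => map_add_atTop_eq_nat 1 ▸ h.1 ε hε, h.2⟩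

theorem convergesToSet_of_isCompact {x : ℕ → Point N} {Y Q : Set (Point N)} (hQ : IsCompact Q)
    (hx : ∀ t, x t ∈ Q) (hY : ∀ y, MapClusterPt y atTop x → y ∈ Y) : ConvergesToSet x Y := by
  refine ⟨fun ε hε => ?_, ?_, hY⟩
  · by_contra hfar
    have hclosed : IsClosed {z | ∀ y ∈ Y, ε ≤ pointDist z y} := by
      simp only [Set.ofPred_forall]
      exact isClosed_biInter fun y _ => isClosed_le continuous_const (continuous_pointDist y)
    obtain ⟨y, ⟨-, hyfar⟩, hy⟩ := (hQ.inter_right hclosed).exists_mapClusterPt_of_frequently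
      ((not_eventually.1 hfar).mono fun t ht => ⟨hx t, by simpa using ht⟩)
    exact absurd (hyfar y (hY y hy)) (by rw [pointDist_self]; exact not_le.2 hε)
  · exact (hQ.exists_mapClusterPt_of_frequently (Frequently.of_forall hx)).imp fun _ h => h.2

theorem tendsto_zero_of_sufficient_decrease {a b : ℕ → ℝ} {c : ℝ} (hc : 0 < c)
    (hb : ∀ t, 0 ≤ b t) (h : ∀ t, a (t + 1) + c * b t ≤ a t) (ha : BddBelow (Set.range a)) :
    Tendsto b atTop (𝓝 0) := by
  have hanti : Antitone a := antitone_nat_of_succ_le fun t => by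
    linarith [h t, mul_nonneg hc.le (hb t)]
  have hlim := tendsto_atTop_ciInf hanti ha
  have hdiff := (hlim.sub (hlim.comp (tendsto_add_atTop_nat 1))).div_const c
  rw [sub_self, zero_div] at hdiff
  refine squeeze_zero hb (fun t => ?_) hdiff
  rw [le_div_iff₀ hc]
  simp only [Function.comp]
  linarith [h t]

end Convergence

namespace Data

section ClosedSteps

variable (P : Data N M K) {ι : Type*} {F : Filter ι}
  {S V : ι → Matrix (Fin N) (Fin N) ℝ} {S₀ V₀ : Matrix (Fin N) (Fin N) ℝ}
  {l u : ι → Fin N → ℝ} {l₀ u₀ : Fin N → ℝ}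

theorem tendsto_step1Obj (hV : Tendsto V F (𝓝 V₀)) (hl : Tendsto l F (𝓝 l₀))
    (hS : Tendsto S F (𝓝 S₀)) :
    Tendsto (fun t => P.step1Obj (V t) (l t) (S t)) F (𝓝 (P.step1Obj V₀ l₀ S₀)) := by
  have hcont : Continuous fun y : Point N => P.step1Obj y.2.1 y.2.2 y.1 := by
    unfold step1Obj
    exact ((continuous_const.matrix_mul continuous_fst).matrix_trace.add
      (continuous_const.mul (continuous_l1Norm.comp continuous_fst))).add
      (continuous_const.mul (continuous_frobSq.comp (continuous_fst.sub
        ((continuous_snd.fst.matrix_mul continuous_snd.snd.matrix_diagonal).matrix_mul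
          continuous_snd.fst.matrix_transpose))))
  have hpoint : Tendsto (fun t => ((S t, V t, l t) : Point N)) F (𝓝 (S₀, V₀, l₀)) :=
    hS.prodMk_nhds (hV.prodMk_nhds hl)
  have hobj := (hcont.tendsto (S₀, V₀, l₀)).comp hpoint
  exact hobj

theorem tendsto_conj (hV : Tendsto V F (𝓝 V₀)) (hS : Tendsto S F (𝓝 S₀)) :
    Tendsto (fun t => (V t)ᵀ * S t * V t) F (𝓝 (V₀ᵀ * S₀ * V₀)) := by
  have hcont : Continuous fun p : Matrix (Fin N) (Fin N) ℝ × Matrix (Fin N) (Fin N) ℝ =>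
      p.1ᵀ * p.2 * p.1 :=
    (continuous_fst.matrix_transpose.matrix_mul continuous_snd).matrix_mul continuous_fst
  have hpair : Tendsto (fun t => (V t, S t)) F (𝓝 (V₀, S₀)) := hV.prodMk_nhds hS
  have hconj := (hcont.tendsto (V₀, S₀)).comp hpair
  exact hconj

theorem tendsto_step3Obj (hc : ConcaveOn ℝ (Set.Ioi 0) P.g)
    (hd : DifferentiableOn ℝ P.g (Set.Ioi 0)) (hu₀ : ∀ i, 0 < u₀ i) (hl₀ : ∀ i, 0 < l₀ i)
    (hS : Tendsto S F (𝓝 S₀)) (hV : Tendsto V F (𝓝 V₀)) (hu : Tendsto u F (𝓝 u₀))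
    (hl : Tendsto l F (𝓝 l₀)) :
    Tendsto (fun t => P.step3Obj (S t) (V t) (u t) (l t)) F (𝓝 (P.step3Obj S₀ V₀ u₀ l₀)) := by
  have hlcoord := tendsto_pi_nhds.1 hl
  have hconj := tendsto_conj hV hS
  unfold step3Obj
  refine Tendsto.add (Tendsto.add (tendsto_finsetSum _ fun j _ => ?_).neg
    (Tendsto.const_mul _ (tendsto_finsetSum _ fun j _ => ?_)))
    (Tendsto.const_mul _ (tendsto_majorizer isOpen_Ioi hc
      (fun a ha => hd.differentiableAt (Ioi_mem_nhds ha)) hu₀ hl hu))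
  · exact (hlcoord j).log (hl₀ j).ne'
  · exact ((hlcoord j).sub (tendsto_pi_nhds.1 (tendsto_pi_nhds.1 hconj j) j)).pow 2

theorem IsExactStep1.of_tendsto [NeBot F] {𝒮 : Set (Matrix (Fin N) (Fin N) ℝ)}
    (hclosed : IsClosed 𝒮) {x : ι → Point N} {y : Point N} (hx : Tendsto x F (𝓝 y))
    (hS : Tendsto S F (𝓝 S₀))
    (h : ∀ t, P.IsExactStep1 𝒮 (x t) (S t)) : P.IsExactStep1 𝒮 y S₀ := by
  have hV : Tendsto (fun t => (x t).2.1) F (𝓝 y.2.1) := (continuous_snd.fst.tendsto y).comp hx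
  have hl : Tendsto (fun t => (x t).2.2) F (𝓝 y.2.2) := (continuous_snd.snd.tendsto y).comp hx
  exact ⟨hclosed.mem_of_tendsto hS (Eventually.of_forall fun t => (h t).1), isMinOn_iff.2
    fun _ hA => le_of_tendsto_of_tendsto' (P.tendsto_step1Obj hV hl hS)
      (P.tendsto_step1Obj hV hl tendsto_const_nhds) fun t => isMinOn_iff.1 (h t).2 _ hA⟩

theorem IsStep2.of_tendsto [NeBot F] (hS : Tendsto S F (𝓝 S₀)) (hl : Tendsto l F (𝓝 l₀))
    (hV : Tendsto V F (𝓝 V₀)) (h : ∀ t, IsStep2 (S t) (l t) (V t)) : IsStep2 S₀ l₀ V₀ := by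
  have hcont : Continuous fun p : Matrix (Fin N) (Fin N) ℝ × (Fin N → ℝ) =>
      trace (p.1 * diagonal p.2) :=
    (continuous_fst.matrix_mul continuous_snd.matrix_diagonal).matrix_trace
  have htrace : ∀ {W : ι → Matrix (Fin N) (Fin N) ℝ} {W₀}, Tendsto W F (𝓝 W₀) →
      Tendsto (fun t => trace ((W t)ᵀ * S t * W t * diagonal (l t))) F
        (𝓝 (trace (W₀ᵀ * S₀ * W₀ * diagonal l₀))) := fun {W W₀} hW => by
    have hpair : Tendsto (fun t => ((W t)ᵀ * S t * W t, l t)) F (𝓝 (W₀ᵀ * S₀ * W₀, l₀)) :=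
      (tendsto_conj hW hS).prodMk_nhds hl
    have hobj := (hcont.tendsto (W₀ᵀ * S₀ * W₀, l₀)).comp hpair
    exact hobj
  have hclosed : IsClosed {W : Matrix (Fin N) (Fin N) ℝ | Wᵀ * W = 1} :=
    isClosed_eq (continuous_id.matrix_transpose.matrix_mul continuous_id) continuous_const
  exact ⟨hclosed.mem_of_tendsto hV (Eventually.of_forall fun t => (h t).1), isMaxOn_iff.2
    fun _ hW => le_of_tendsto_of_tendsto' (htrace tendsto_const_nhds) (htrace hV)
      fun t => isMaxOn_iff.1 (h t).2 _ hW⟩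

theorem IsStep3.of_tendsto [NeBot F] (hc : ConcaveOn ℝ (Set.Ioi 0) P.g)
    (hd : DifferentiableOn ℝ P.g (Set.Ioi 0)) (hu₀ : ∀ i, 0 < u₀ i) (hl₀ : ∀ i, 0 < l₀ i)
    (hS : Tendsto S F (𝓝 S₀)) (hV : Tendsto V F (𝓝 V₀)) (hu : Tendsto u F (𝓝 u₀))
    (hl : Tendsto l F (𝓝 l₀)) (h : ∀ t, P.IsStep3 (S t) (V t) (u t) (l t)) :
    P.IsStep3 S₀ V₀ u₀ l₀ := by
  have hcg := (hasFDerivAt_cg fun i => hd.differentiableAt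
    (Ioi_mem_nhds (hl₀ i))).continuousAt.tendsto.comp hl
  exact ⟨⟨hl₀, ge_of_tendsto hcg (Eventually.of_forall fun t => (h t).1.2)⟩, isMinOn_iff.2
    fun _ hw => le_of_tendsto_of_tendsto' (P.tendsto_step3Obj hc hd hu₀ hl₀ hS hV hu hl)
      (P.tendsto_step3Obj hc hd hu₀ hw.1 hS hV hu tendsto_const_nhds)
      fun t => isMinOn_iff.1 (h t).2 _ hw⟩

end ClosedSteps

section DescentRun

variable (P : Data N M K) {𝒮 : Set (Matrix (Fin N) (Fin N) ℝ)} {x : ℕ → Point N}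

theorem bddBelow_objective_image_feasible (hα : 0 < P.α) (hβ : 0 < P.β) (hγ : 0 ≤ P.γ) :
    BddBelow (P.objective '' P.feasible 𝒮) := by
  obtain ⟨a, ha, C, hcoercive⟩ := P.exists_coercive_bound (N := N) hα hβ hγ
  refine ⟨∑ _k : Fin N, (1 + Real.log a) - C, ?_⟩
  rintro _ ⟨x, hx, rfl⟩
  have hlog := Finset.sum_le_sum fun k (_ : k ∈ Finset.univ) => one_add_log_le ha (hx.2.2.1 k)
  linarith [hcoercive 𝒮 x hx, mul_nonneg (half_pos hα).le (l1Norm_nonneg x.1)]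

/-- Runs of the three-block scheme whose first step, exact or not, decreases the first subproblem
by at least `β/4` times the squared step length. -/
structure IsDescentRun (𝒮 : Set (Matrix (Fin N) (Fin N) ℝ)) (x : ℕ → Point N) : Prop where
  feasible : ∀ t, x t ∈ P.feasible 𝒮
  step1 : ∀ t, P.step1Obj (x t).2.1 (x t).2.2 (x (t + 1)).1
    + P.β / 4 * frobSq ((x (t + 1)).1 - (x t).1) ≤ P.step1Obj (x t).2.1 (x t).2.2 (x t).1
  step2 : ∀ t, IsStep2 (x (t + 1)).1 (x t).2.2 (x (t + 1)).2.1
  step3 : ∀ t, P.IsStep3 (x (t + 1)).1 (x (t + 1)).2.1 (x t).2.2 (x (t + 1)).2.2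

namespace IsDescentRun

variable {P}

theorem objective_add_le (hx : P.IsDescentRun 𝒮 x) (hβ : 0 ≤ P.β) (hγ : 0 ≤ P.γ)
    (hc : ConcaveOn ℝ (Set.Ioi 0) P.g) (hd : DifferentiableOn ℝ P.g (Set.Ioi 0)) (t : ℕ) :
    P.objective (x (t + 1)) + P.β / 4 * (frobSq ((x (t + 1)).1 - (x t).1)
      + ∑ j, ((x (t + 1)).2.2 j - (x t).2.2 j) ^ 2) ≤ P.objective (x t) :=
  P.objective_add_le_of_sweep hβ hγ hc hd (hx.feasible t) (hx.step1 t) (hx.step2 t) (hx.step3 t)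

theorem exists_isCompact (hx : P.IsDescentRun 𝒮 x) (hα : 0 < P.α) (hβ : 0 < P.β) (hγ : 0 ≤ P.γ)
    (hc : ConcaveOn ℝ (Set.Ioi 0) P.g) (hd : DifferentiableOn ℝ P.g (Set.Ioi 0)) :
    ∃ Q : Set (Point N), IsCompact Q ∧ (∀ y ∈ Q, ∀ i, 0 < y.2.2 i) ∧ ∀ t, x t ∈ Q := by
  have hanti : Antitone fun t => P.objective (x t) := antitone_nat_of_succ_le fun t =>
    (le_add_of_nonneg_right (mul_nonneg (by positivity)
      (add_nonneg (frobSq_nonneg _) (by positivity)))).trans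
      (hx.objective_add_le hβ.le hγ hc hd t)
  obtain ⟨Q, hQ, hpos, hmem⟩ := P.exists_compact_sublevel hα hβ hγ (P.objective (x 0))
  exact ⟨Q, hQ, hpos, fun t => hmem 𝒮 _ (hx.feasible t) (hanti (Nat.zero_le t))⟩

theorem tendsto_step_zero (hx : P.IsDescentRun 𝒮 x) (hα : 0 < P.α) (hβ : 0 < P.β) (hγ : 0 ≤ P.γ)
    (hc : ConcaveOn ℝ (Set.Ioi 0) P.g) (hd : DifferentiableOn ℝ P.g (Set.Ioi 0)) :
    Tendsto (fun t => (x (t + 1)).1 - (x t).1) atTop (𝓝 0) ∧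
      Tendsto (fun t => (x (t + 1)).2.2 - (x t).2.2) atTop (𝓝 0) := by
  have hsq : ∀ t, 0 ≤ ∑ j, ((x (t + 1)).2.2 j - (x t).2.2 j) ^ 2 := fun t => by positivity
  have hgap := tendsto_zero_of_sufficient_decrease (by positivity : 0 < P.β / 4)
    (fun t => add_nonneg (frobSq_nonneg _) (hsq t)) (hx.objective_add_le hβ.le hγ hc hd)
    ((P.bddBelow_objective_image_feasible hα hβ hγ).mono
      (Set.range_subset_iff.2 fun t => Set.mem_image_of_mem _ (hx.feasible t)))
  exact ⟨tendsto_zero_of_frobSq (squeeze_zero (fun _ => frobSq_nonneg _)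
      (fun t => le_add_of_nonneg_right (hsq t)) hgap),
    tendsto_zero_of_sum_sq (squeeze_zero hsq
      (fun t => le_add_of_nonneg_left (frobSq_nonneg _)) hgap)⟩

theorem isBlockOptimal_of_mapClusterPt (hx : P.IsDescentRun 𝒮 x) (hα : 0 < P.α) (hβ : 0 < P.β)
    (hγ : 0 ≤ P.γ) (hc : ConcaveOn ℝ (Set.Ioi 0) P.g) (hd : DifferentiableOn ℝ P.g (Set.Ioi 0))
    {y : Point N}
    (hlim : ∀ F : Filter ℕ, F.NeBot → Tendsto x F (𝓝 y) →
      Tendsto (fun t => (x (t + 1)).1) F (𝓝 y.1) → P.IsExactStep1 𝒮 y y.1)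
    (hy : MapClusterPt y atTop x) : P.IsBlockOptimal 𝒮 y := by
  obtain ⟨Q, hQ, hpos, hxQ⟩ := hx.exists_isCompact hα hβ hγ hc hd
  obtain ⟨hSstep, hlstep⟩ := hx.tendsto_step_zero hα hβ hγ hc hd
  obtain ⟨U, hU, hxU⟩ := mapClusterPt_iff_ultrafilter.1 (mapClusterPt_succ_iff.2 hy)
  have hyl : ∀ i, 0 < y.2.2 i :=
    hpos y (hQ.isClosed.mem_of_tendsto hxU (Eventually.of_forall fun t => hxQ _))
  have hS : Tendsto (fun t => (x (t + 1)).1) U (𝓝 y.1) := (continuous_fst.tendsto y).comp hxU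
  have hV : Tendsto (fun t => (x (t + 1)).2.1) U (𝓝 y.2.1) :=
    (continuous_snd.fst.tendsto y).comp hxU
  have hl : Tendsto (fun t => (x (t + 1)).2.2) U (𝓝 y.2.2) :=
    (continuous_snd.snd.tendsto y).comp hxU
  have hlprev : Tendsto (fun t => (x t).2.2) U (𝓝 y.2.2) := by
    simpa using hl.sub (hlstep.mono_left hU)
  have hSnext : Tendsto (fun t => (x (t + 1 + 1)).1) U (𝓝 y.1) := by
    simpa using ((hSstep.comp (tendsto_add_atTop_nat 1)).mono_left hU).add hS
  exact ⟨hlim (map (· + 1) (U : Filter ℕ)) inferInstance (tendsto_map'_iff.2 hxU)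
      (tendsto_map'_iff.2 hSnext),
    IsStep2.of_tendsto hS hlprev hV hx.step2,
    IsStep3.of_tendsto P hc hd hyl hyl hS hV hlprev hl hx.step3⟩

theorem convergesToSet (hx : P.IsDescentRun 𝒮 x) (hα : 0 < P.α) (hβ : 0 < P.β) (hγ : 0 ≤ P.γ)
    (hc : ConcaveOn ℝ (Set.Ioi 0) P.g) (hd : DifferentiableOn ℝ P.g (Set.Ioi 0))
    (hlim : ∀ (F : Filter ℕ) (y : Point N), F.NeBot → Tendsto x F (𝓝 y) →
      Tendsto (fun t => (x (t + 1)).1) F (𝓝 y.1) → P.IsExactStep1 𝒮 y y.1) :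
    ConvergesToSet x (P.stationary 𝒮) := by
  obtain ⟨Q, hQ, -, hxQ⟩ := hx.exists_isCompact hα hβ hγ hc hd
  exact convergesToSet_of_isCompact hQ hxQ fun y hy =>
    (hx.isBlockOptimal_of_mapClusterPt hα hβ hγ hc hd (fun F => hlim F y) hy).mem_stationary
      P hα.le hβ.le hd

end IsDescentRun

theorem IsExactRun.convergesToSet (hα : 0 < P.α) (hβ : 0 < P.β) (hγ : 0 ≤ P.γ)
    (hc : ConcaveOn ℝ (Set.Ioi 0) P.g) (hd : DifferentiableOn ℝ P.g (Set.Ioi 0))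
    (hclosed : IsClosed 𝒮) (hconv : Convex ℝ 𝒮) (hx : P.IsExactRun 𝒮 x) :
    ConvergesToSet x (P.stationary 𝒮) := by
  have hfeasible : ∀ t, x (t + 1) ∈ P.feasible 𝒮 := fun t =>
    ⟨(hx.2 t).1.1, (hx.2 t).2.1.1, (hx.2 t).2.2.1⟩
  have hrun : P.IsDescentRun 𝒮 fun t => x (t + 1) := ⟨hfeasible,
    fun t => (hx.2 (t + 1)).1.quadratic_growth P hα.le hconv (hfeasible t).1,
    fun t => (hx.2 (t + 1)).2.1, fun t => (hx.2 (t + 1)).2.2⟩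
  exact convergesToSet_of_succ (hrun.convergesToSet hα hβ hγ hc hd fun F y _ hy hS =>
    IsExactStep1.of_tendsto P hclosed hy hS fun t => (hx.2 (t + 1)).1)

end DescentRun

end Data

theorem sub_mul_sub_max_zero_nonneg {R : Type*} [Ring R] [LinearOrder R] [IsOrderedRing R]
    (u : R) {w : R} (hw : 0 ≤ w) : 0 ≤ (max u 0 - u) * (w - max u 0) := by
  rcases le_total u 0 with hu | hu
  · simpa [max_eq_right hu] using mul_nonneg (neg_nonneg.2 hu) hw
  · simp [max_eq_left hu]

namespace Data

variable {m : ℕ} {𝓢 : (Fin m → ℝ) →ₗ[ℝ] Matrix (Fin N) (Fin N) ℝ}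

section Adjoint

theorem adj_dotProduct (Y : Matrix (Fin N) (Fin N) ℝ) (s : Fin m → ℝ) :
    adj 𝓢 Y ⬝ᵥ s = trace ((𝓢 s)ᵀ * Y) := by
  have hs : 𝓢 s = ∑ k, s k • 𝓢 (Pi.single k 1) := by
    conv_lhs => rw [pi_eq_sum_univ' s]
    simp only [map_sum, map_smul]
  simp only [hs, transpose_sum, transpose_smul, Finset.sum_mul, trace_sum, smul_mul, trace_smul,
    trace_transpose_mul_eq_sum, dotProduct, adj, smul_eq_mul, mul_comm]

theorem continuous_adj : Continuous (adj 𝓢) :=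
  continuous_pi fun _ => continuous_finsetSum _ fun i _ => continuous_finsetSum _ fun j _ =>
    continuous_const.mul (continuous_id.matrix_elem i j)

theorem bddAbove_frobSq_sphere (𝓢 : (Fin m → ℝ) →ₗ[ℝ] Matrix (Fin N) (Fin N) ℝ) :
    BddAbove {r | ∃ s : Fin m → ℝ, ∑ k, s k ^ 2 = 1 ∧ r = frobSq (𝓢 s)} := by
  have hcube : IsCompact (Set.univ.pi fun _ : Fin m => Set.Icc (-1 : ℝ) 1) :=
    isCompact_univ_pi fun _ => isCompact_Icc
  refine (hcube.image (continuous_frobSq.comp 𝓢.continuous_of_finiteDimensional)).bddAbove.mono ?_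
  rintro _ ⟨s, hs, rfl⟩
  refine ⟨s, fun k _ => abs_le.1 ?_, rfl⟩
  rw [← sq_le_one_iff_abs_le_one, ← hs]
  exact Finset.single_le_sum (f := fun k => s k ^ 2) (fun _ _ => sq_nonneg _) (Finset.mem_univ k)

theorem frobSq_apply_le (s : Fin m → ℝ) : frobSq (𝓢 s) ≤ opNormSq 𝓢 * ∑ k, s k ^ 2 := by
  have hsum : 0 ≤ ∑ k, s k ^ 2 := by positivity
  rcases hsum.eq_or_lt with hzero | hpos
  · have hs : s = 0 := funext fun k => pow_eq_zero_iff two_ne_zero |>.1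
      ((Finset.sum_eq_zero_iff_of_nonneg fun _ _ => sq_nonneg _).1 hzero.symm k (Finset.mem_univ k))
    simp [hs, frobSq]
  · have hunit : ∑ k, ((√(∑ k, s k ^ 2))⁻¹ • s) k ^ 2 = 1 := by
      simp only [Pi.smul_apply, smul_eq_mul, mul_pow, ← Finset.mul_sum, inv_pow,
        Real.sq_sqrt hsum, inv_mul_cancel₀ hpos.ne']
    have hle : frobSq (𝓢 ((√(∑ k, s k ^ 2))⁻¹ • s)) ≤ opNormSq 𝓢 :=
      le_csSup (bddAbove_frobSq_sphere 𝓢) ⟨_, hunit, rfl⟩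
    rwa [map_smul, frobSq_smul, inv_pow, Real.sq_sqrt hsum, inv_mul_le_iff₀ hpos, mul_comm] at hle

theorem opNormSq_pos [Nonempty (Fin m)] (hinj : Function.Injective 𝓢) : 0 < opNormSq 𝓢 := by
  obtain ⟨k⟩ := ‹Nonempty (Fin m)›
  have hne : 𝓢 (Pi.single k 1) ≠ 0 := by simp [map_eq_zero_iff 𝓢 hinj]
  have hpos : 0 < frobSq (𝓢 (Pi.single k 1)) :=
    (frobSq_nonneg _).lt_of_ne' (mt frobSq_eq_zero_iff.1 hne)
  simpa [Pi.single_apply, ite_pow] using hpos.trans_le (frobSq_apply_le (Pi.single k 1))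

end Adjoint

section GradientStep

variable (P : Data N M K) {H : Matrix (Fin N) (Fin N) ℝ}

/-- The direction `𝓢*(𝓢 s) - z` of the projected-gradient update: up to the factor `β`, the
gradient in `s` of the first subproblem on the nonnegative orthant. -/
noncomputable def step1Grad (𝓢 : (Fin m → ℝ) →ₗ[ℝ] Matrix (Fin N) (Fin N) ℝ)
    (H V : Matrix (Fin N) (Fin N) ℝ) (l : Fin N → ℝ) (s : Fin m → ℝ) : Fin m → ℝ :=
  adj 𝓢 (𝓢 s) - P.zVec 𝓢 H V l

theorem step1Obj_apply_eq (hβ : P.β ≠ 0) (hsymm : ∀ s, (𝓢 s).IsSymm)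
    (hH : ∀ s : Fin m → ℝ, (∀ k, 0 ≤ s k) → l1Norm (𝓢 s) = trace (𝓢 s * H))
    (V : Matrix (Fin N) (Fin N) ℝ) (l : Fin N → ℝ) {s w : Fin m → ℝ}
    (hs : ∀ k, 0 ≤ s k) (hw : ∀ k, 0 ≤ w k) :
    P.step1Obj V l (𝓢 w) = P.step1Obj V l (𝓢 s)
      + P.β * (P.step1Grad 𝓢 H V l s ⬝ᵥ (w - s)) + P.β / 2 * frobSq (𝓢 (w - s)) := by
  have hw_eq : 𝓢 w = 𝓢 s + 𝓢 (w - s) := by rw [← map_add, add_sub_cancel]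
  have hquad : ∀ B : Matrix (Fin N) (Fin N) ℝ, frobSq (𝓢 w - B)
      = frobSq (𝓢 s - B) + 2 * trace (𝓢 (w - s) * (𝓢 s - B)) + frobSq (𝓢 (w - s)) := fun B => by
    rw [hw_eq, add_sub_right_comm, frobSq_add, ← trace_transpose ((𝓢 s - B)ᵀ * _), transpose_mul,
      transpose_transpose, (hsymm _).eq]
  have hl1 : l1Norm (𝓢 w) = l1Norm (𝓢 s) + trace (𝓢 (w - s) * H) := by
    rw [hH w hw, hH s hs, hw_eq, add_mul, trace_add]
  have hgrad : P.β * (P.step1Grad 𝓢 H V l s ⬝ᵥ (w - s))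
      = P.β * trace (𝓢 (w - s) * (𝓢 s - V * diagonal l * Vᵀ))
        + trace (𝓢 (w - s) * empCov P.X) + P.α * trace (𝓢 (w - s) * H) := by
    simp only [step1Grad, zVec, sub_dotProduct, adj_dotProduct, (hsymm _).eq, Matrix.mul_sub,
      Matrix.mul_add, Matrix.mul_smul, trace_sub, trace_add, trace_smul, smul_eq_mul]
    field_simp
    ring
  simp only [step1Obj, hquad, hl1, hgrad, trace_mul_comm (empCov P.X)]
  rw [hw_eq, add_mul, trace_add]
  ring

theorem gradStep1_nonneg (V : Matrix (Fin N) (Fin N) ℝ) (l : Fin N → ℝ) (s : Fin m → ℝ)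
    (k : Fin m) : 0 ≤ P.gradStep1 𝓢 H V l s k :=
  le_max_right _ _

theorem gradStep1_variational (hinj : Function.Injective 𝓢) (V : Matrix (Fin N) (Fin N) ℝ)
    (l : Fin N → ℝ) (s : Fin m → ℝ) {w : Fin m → ℝ} (hw : ∀ k, 0 ≤ w k) :
    0 ≤ (opNormSq 𝓢 • (P.gradStep1 𝓢 H V l s - s) + P.step1Grad 𝓢 H V l s) ⬝ᵥ
      (w - P.gradStep1 𝓢 H V l s) := by
  refine Finset.sum_nonneg fun k _ => ?_
  have : Nonempty (Fin m) := ⟨k⟩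
  have hL := opNormSq_pos hinj
  have hproj := mul_nonneg hL.le (sub_mul_sub_max_zero_nonneg
    (s k - 1 / opNormSq 𝓢 * P.step1Grad 𝓢 H V l s k) (hw k))
  refine hproj.trans_eq ?_
  change _ = (opNormSq 𝓢 * (P.gradStep1 𝓢 H V l s k - s k) + P.step1Grad 𝓢 H V l s k)
    * (w k - P.gradStep1 𝓢 H V l s k)
  rw [show P.gradStep1 𝓢 H V l s k = max (s k - 1 / opNormSq 𝓢 * P.step1Grad 𝓢 H V l s k) 0
    from rfl]
  field_simp
  ring

theorem step1Obj_gradStep1_add_le (hβ : 0 < P.β) (hinj : Function.Injective 𝓢)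
    (hsymm : ∀ s, (𝓢 s).IsSymm)
    (hH : ∀ s : Fin m → ℝ, (∀ k, 0 ≤ s k) → l1Norm (𝓢 s) = trace (𝓢 s * H))
    (V : Matrix (Fin N) (Fin N) ℝ) (l : Fin N → ℝ) {s : Fin m → ℝ} (hs : ∀ k, 0 ≤ s k) :
    P.step1Obj V l (𝓢 (P.gradStep1 𝓢 H V l s))
      + P.β / 2 * frobSq (𝓢 (P.gradStep1 𝓢 H V l s) - 𝓢 s) ≤ P.step1Obj V l (𝓢 s) := by
  have hexpand := P.step1Obj_apply_eq hβ.ne' hsymm hH V l hs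
    (P.gradStep1_nonneg (𝓢 := 𝓢) (H := H) V l s)
  have hvar := P.gradStep1_variational (H := H) hinj V l s hs
  set p := P.gradStep1 𝓢 H V l s
  have hlin : P.step1Grad 𝓢 H V l s ⬝ᵥ (p - s) ≤ -(opNormSq 𝓢 * ∑ k, (p - s) k ^ 2) := by
    have hsq : ∑ k, (p - s) k ^ 2 = (p - s) ⬝ᵥ (p - s) := by simp only [dotProduct, sq]
    rw [← neg_sub p s, dotProduct_neg, add_dotProduct, smul_dotProduct, smul_eq_mul] at hvar
    rw [hsq]
    linarith
  have hdescent := hlin.trans (neg_le_neg (frobSq_apply_le (p - s)))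
  rw [hexpand, ← map_sub]
  linarith [mul_le_mul_of_nonneg_left hdescent hβ.le]

theorem isExactStep1_of_gradStep1_eq (hβ : 0 < P.β) (hinj : Function.Injective 𝓢)
    (hsymm : ∀ s, (𝓢 s).IsSymm)
    (hH : ∀ s : Fin m → ℝ, (∀ k, 0 ≤ s k) → l1Norm (𝓢 s) = trace (𝓢 s * H))
    {y : Point N} {s : Fin m → ℝ} (hfix : P.gradStep1 𝓢 H y.2.1 y.2.2 s = s) :
    P.IsExactStep1 (cone 𝓢) y (𝓢 s) := by
  have hs : ∀ k, 0 ≤ s k := fun k => hfix ▸ P.gradStep1_nonneg y.2.1 y.2.2 s k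
  refine ⟨⟨s, hs, rfl⟩, isMinOn_iff.2 ?_⟩
  rintro _ ⟨w, hw, rfl⟩
  have hexpand := P.step1Obj_apply_eq hβ.ne' hsymm hH y.2.1 y.2.2 hs hw
  have hvar : 0 ≤ P.step1Grad 𝓢 H y.2.1 y.2.2 s ⬝ᵥ (w - s) := by
    simpa [hfix] using P.gradStep1_variational (H := H) hinj y.2.1 y.2.2 s hw
  rw [hexpand, add_assoc]
  exact le_add_of_nonneg_right (add_nonneg (mul_nonneg hβ.le hvar)
    (mul_nonneg (half_pos hβ).le (frobSq_nonneg _)))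

theorem tendsto_gradStep1 {ι : Type*} {F : Filter ι} {V : ι → Matrix (Fin N) (Fin N) ℝ}
    {l : ι → Fin N → ℝ} {s : ι → Fin m → ℝ} {V₀ : Matrix (Fin N) (Fin N) ℝ} {l₀ : Fin N → ℝ}
    {s₀ : Fin m → ℝ} (hV : Tendsto V F (𝓝 V₀)) (hl : Tendsto l F (𝓝 l₀))
    (hs : Tendsto s F (𝓝 s₀)) :
    Tendsto (fun t => P.gradStep1 𝓢 H (V t) (l t) (s t)) F (𝓝 (P.gradStep1 𝓢 H V₀ l₀ s₀)) := by
  have hz : Continuous fun p : Point N => P.zVec 𝓢 H p.2.1 p.2.2 :=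
    continuous_adj.comp (((continuous_snd.fst.matrix_mul
      continuous_snd.snd.matrix_diagonal).matrix_mul
        continuous_snd.fst.matrix_transpose).sub continuous_const)
  have hztendsto : Tendsto (fun t => P.zVec 𝓢 H (V t) (l t)) F (𝓝 (P.zVec 𝓢 H V₀ l₀)) := by
    have hpoint : Tendsto (fun t => ((0, V t, l t) : Point N)) F (𝓝 (0, V₀, l₀)) :=
      tendsto_const_nhds.prodMk_nhds (hV.prodMk_nhds hl)
    have hcomp := (hz.tendsto (0, V₀, l₀)).comp hpoint
    exact hcomp
  have hadj : Tendsto (fun t => adj 𝓢 (𝓢 (s t))) F (𝓝 (adj 𝓢 (𝓢 s₀))) :=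
    ((continuous_adj.comp 𝓢.continuous_of_finiteDimensional).tendsto s₀).comp hs
  exact tendsto_pi_nhds.2 fun k => ((tendsto_pi_nhds.1 hs k).sub (tendsto_const_nhds.mul
    ((tendsto_pi_nhds.1 hadj k).sub (tendsto_pi_nhds.1 hztendsto k)))).max tendsto_const_nhds

theorem isExactStep1_of_tendsto_gradStep1 (hβ : 0 < P.β) (hinj : Function.Injective 𝓢)
    (hsymm : ∀ s, (𝓢 s).IsSymm)
    (hH : ∀ s : Fin m → ℝ, (∀ k, 0 ≤ s k) → l1Norm (𝓢 s) = trace (𝓢 s * H))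
    {ι : Type*} {F : Filter ι} [NeBot F] {x : ι → Point N} {s : ι → Fin m → ℝ} {y : Point N}
    (hS : ∀ t, (x t).1 = 𝓢 (s t)) (hx : Tendsto x F (𝓝 y))
    (hnext : Tendsto (fun t => 𝓢 (P.gradStep1 𝓢 H (x t).2.1 (x t).2.2 (s t))) F (𝓝 y.1)) :
    P.IsExactStep1 (cone 𝓢) y y.1 := by
  have hemb := LinearMap.isClosedEmbedding_of_injective (LinearMap.ker_eq_bot.2 hinj)
  have hxS : Tendsto (fun t => 𝓢 (s t)) F (𝓝 y.1) :=
    ((continuous_fst.tendsto y).comp hx).congr hS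
  obtain ⟨s₀, hs₀⟩ := hemb.isClosed_range.mem_of_tendsto hxS
    (Eventually.of_forall fun t => Set.mem_range_self (s t))
  rw [← hs₀] at hxS hnext
  have hfix : P.gradStep1 𝓢 H y.2.1 y.2.2 s₀ = s₀ := tendsto_nhds_unique
    (P.tendsto_gradStep1 ((continuous_snd.fst.tendsto y).comp hx)
      ((continuous_snd.snd.tendsto y).comp hx) (hemb.isInducing.tendsto_nhds_iff.2 hxS))
    (hemb.isInducing.tendsto_nhds_iff.2 hnext)
  exact hs₀ ▸ P.isExactStep1_of_gradStep1_eq hβ hinj hsymm hH hfix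

theorem IsGradRun.convergesToSet (hα : 0 < P.α) (hβ : 0 < P.β) (hγ : 0 ≤ P.γ)
    (hc : ConcaveOn ℝ (Set.Ioi 0) P.g) (hd : DifferentiableOn ℝ P.g (Set.Ioi 0))
    (hinj : Function.Injective 𝓢) (hsymm : ∀ s, (𝓢 s).IsSymm)
    (hH : ∀ s : Fin m → ℝ, (∀ k, 0 ≤ s k) → l1Norm (𝓢 s) = trace (𝓢 s * H))
    {s : ℕ → Fin m → ℝ} {x : ℕ → Point N} (hx : P.IsGradRun 𝓢 H s x) :
    ConvergesToSet x (P.stationary (cone 𝓢)) := by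
  have hs : ∀ t k, 0 ≤ s (t + 1) k := fun t k => by
    rw [(hx.2 t).1]; exact P.gradStep1_nonneg _ _ _ _
  have hS : ∀ t, (x (t + 1)).1 = 𝓢 (s (t + 1)) := fun t => (hx.2 t).2.1
  have hnext : ∀ t, (x (t + 1 + 1)).1
      = 𝓢 (P.gradStep1 𝓢 H (x (t + 1)).2.1 (x (t + 1)).2.2 (s (t + 1))) := fun t => by
    rw [hS, (hx.2 (t + 1)).1]
  have hdecrease : ∀ t, P.step1Obj (x (t + 1)).2.1 (x (t + 1)).2.2 (x (t + 1 + 1)).1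
      + P.β / 4 * frobSq ((x (t + 1 + 1)).1 - (x (t + 1)).1)
        ≤ P.step1Obj (x (t + 1)).2.1 (x (t + 1)).2.2 (x (t + 1)).1 := fun t => by
    have hstep := P.step1Obj_gradStep1_add_le hβ hinj hsymm hH (x (t + 1)).2.1 (x (t + 1)).2.2
      (hs t)
    rw [← hnext, ← hS] at hstep
    linarith [mul_nonneg hβ.le (frobSq_nonneg ((x (t + 1 + 1)).1 - (x (t + 1)).1))]
  have hrun : P.IsDescentRun (cone 𝓢) fun t => x (t + 1) :=
    ⟨fun t => ⟨⟨s (t + 1), hs t, (hS t).symm⟩, (hx.2 t).2.2.1.1, (hx.2 t).2.2.2.1⟩, hdecrease,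
      fun t => (hx.2 (t + 1)).2.2.1, fun t => (hx.2 (t + 1)).2.2.2⟩
  exact convergesToSet_of_succ (hrun.convergesToSet hα hβ hγ hc hd fun F y _ hy hSnext =>
    P.isExactStep1_of_tendsto_gradStep1 hβ hinj hsymm hH hS hy (hSnext.congr hnext))

end GradientStep

end Data

end MotifGL

theorem proposition1_general {N M K : ℕ} (P : MotifGL.Data N M K)
    (hα : 0 < P.α) (hβ : 0 < P.β) (hγ : 0 ≤ P.γ)
    (hconc : ConcaveOn ℝ (Set.Ioi 0) P.g) (hdiff : DifferentiableOn ℝ P.g (Set.Ioi 0)) :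
    (∀ 𝒮 : Set (Matrix (Fin N) (Fin N) ℝ), IsClosed 𝒮 → Convex ℝ 𝒮 →
      ∀ x : ℕ → MotifGL.Point N, P.IsExactRun 𝒮 x →
        MotifGL.ConvergesToSet x (P.stationary 𝒮)) ∧
    (∀ (m : ℕ) (𝓢 : (Fin m → ℝ) →ₗ[ℝ] Matrix (Fin N) (Fin N) ℝ)
      (H : Matrix (Fin N) (Fin N) ℝ), Function.Injective 𝓢 → (∀ s, (𝓢 s).IsSymm) →
      (∀ s : Fin m → ℝ, (∀ k, 0 ≤ s k) → MotifGL.l1Norm (𝓢 s) = Matrix.trace (𝓢 s * H)) →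
      ∀ (s : ℕ → Fin m → ℝ) (x : ℕ → MotifGL.Point N), P.IsGradRun 𝓢 H s x →
        MotifGL.ConvergesToSet x (P.stationary (MotifGL.Data.cone 𝓢))) :=
  ⟨fun _ hclosed hconv _ hx => hx.convergesToSet P hα hβ hγ hconc hdiff hclosed hconv,
    fun _ _ _ hinj hsymm hH _ _ hx => hx.convergesToSet P hα hβ hγ hconc hdiff hinj hsymm hH⟩

theorem proposition1 {N M K : ℕ} (P : MotifGL.Data N M K)
    (hα : 0 < P.α) (hβ : 0 < P.β) (hγ : 0 ≤ P.γ)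
    (hconc : ConcaveOn ℝ (Set.Ioi 0) P.g) (hdiff : DifferentiableOn ℝ P.g (Set.Ioi 0)) :
    -- Step 1 solved exactly, over a closed convex set of symmetric shift operators
    (∀ 𝒮 : Set (Matrix (Fin N) (Fin N) ℝ), IsClosed 𝒮 → Convex ℝ 𝒮 → (∀ S ∈ 𝒮, S.IsSymm) →
      ∀ x : ℕ → MotifGL.Point N, P.IsExactRun 𝒮 x →
        MotifGL.ConvergesToSet x (P.stationary 𝒮)) ∧
    -- Step 1 by the projected-gradient update
    (∀ (m : ℕ) (𝓢 : (Fin m → ℝ) →ₗ[ℝ] Matrix (Fin N) (Fin N) ℝ)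
      (H : Matrix (Fin N) (Fin N) ℝ), Function.Injective 𝓢 → (∀ s, (𝓢 s).IsSymm) →
      (∀ s : Fin m → ℝ, (∀ k, 0 ≤ s k) → MotifGL.l1Norm (𝓢 s) = Matrix.trace (𝓢 s * H)) →
      ∀ (s : ℕ → Fin m → ℝ) (x : ℕ → MotifGL.Point N), P.IsGradRun 𝓢 H s x →
        MotifGL.ConvergesToSet x (P.stationary (MotifGL.Data.cone 𝓢))) :=
  have h := proposition1_general P hα hβ hγ hconc hdiff
  ⟨fun 𝒮 hclosed hconv _ => h.1 𝒮 hclosed hconv, h.2⟩
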